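/- **Setting.** Let $d\ge 2$, let $r_1,\dots,r_d\ge 1$ be integers and let $s_1,\dots,s_d\in\{1,2,3,\dots\}\cup\{\infty\}$ be such that $\frac{r_1}{s_1}\ge\cdots\ge\frac{r_d}{s_d}$ (with $r/\infty=0$). Put $r=r_1+\cdots+r_d$. *Weyl algebra.* Consider coordinates $x^\mu_k$ ($1\le\mu\le d$, $k\ge1$), filtered by $k\le p$ ($p\ge 0$). The completed Weyl algebra $\widehat{\mathcal D}$ consists of formal series in normally ordered monomials in $\hbar^{1/2}$, $x^\mu_k$, $\hbar\partial_{x^\mu_k}$ such that, for each $p$, only finitely many monomials with all derivatives among the $\hbar\partial_{x^\nu_l}$, $l\le p$, occur. The generators $\hbar^{1/2}$, $x^\mu_k$ and $\hbar\partial_{x^\mu_k}$ all have degree $1$. A family of elements of $\widehat{\mathcal D}$ is filtered if, for each $p$, only finitely many pairs (member of the family, such monomial of that member) occur. *Airy structures.* A filtered family $(H_i)_{i\in I}$ in $\widehat{\mathcal D}$ is an Airy structure if there are matrices $\mathcal N=(\mathcal N_{a,i})$ and $\mathcal M=(\mathcal M_{i,a})$, with $a$ running over the pairs $(\mu,k)$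 and $i$ over $I$, which are inverse to each other, such that for each $i$ only finitely many $\mathcal N_{a,i}$ are nonzero, for each $a$ only finitely many $\mathcal M_{i,a}$ are nonzero, and $\tilde H_a=\sum_i\mathcal N_{a,i}H_i$ is a filtered family satisfying * $\tilde H_a=\hbar\partial_{x_a}+(\text{terms of degree}\ge2)$ for all $a$; * $[\tilde H_a,\tilde H_b]=\hbar\sum_c f^c_{a,b}\tilde H_c$ for some $f^c_{a,b}\in\widehat{\mathcal D}$, the sum being taken coefficientwise. *Modes.* For $Q_\mu,t_\mu\in\mathbb C$ let $J^\mu_k=\hbar\partial_{x^\mu_k}$ for $k>0$, $J^\mu_0=\hbar^{1/2}Q_\mu$, and $J^\mu_{k}=-k\,x^\mu_{-k}-r_\mu t_\mu\delta_{-k,s_\mu}$ for $k<0$ (no shift if $s_\mu=\infty$). For $i\ge 1$ and $k\in\mathbb Z$ set $$H_{i,k}=\sum_{M\subseteq\{1,\dots,d\}}\ \sum_{\substack{1\le i_\mu\le r_\mu\ (\mu\in M)\\ \sum_\mu i_\mu=i}}\ \sum_{\substack{(k_\mu)\in\mathbb Z^M\\ \sum_\mu k_\mu=k}}\ \prod_{\mu\in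 M}\frac{1}{r_\mu^{i_\mu-1}}W^\mu_{i_\mu,k_\mu},$$ $$W^\mu_{i,k}=\frac1{r_\mu}\sum_{j=0}^{\lfloor i/2\rfloor}\frac{i!\,\hbar^j}{2^jj!(i-2j)!}\sum_{\substack{p_{2j+1},\dots,p_i\in\mathbb Z\\ \sum_l p_l=r_\mu k}}\Psi^{(j)}_{r_\mu}(p_{2j+1},\dots,p_i)\,{:}\prod_{l=2j+1}^iJ^\mu_{p_l}{:}\,,$$ $$\Psi^{(j)}_{\rho}(a_{2j+1},\dots,a_i)=\frac1{i!}\sum_{\substack{m_1,\dots,m_i\in\{0,\dots,\rho-1\}\\ \text{pairwise distinct}}}\ \prod_{l'=1}^j\frac{\theta^{m_{2l'-1}+m_{2l'}}}{(\theta^{m_{2l'}}-\theta^{m_{2l'-1}})^2}\prod_{l=2j+1}^i\theta^{-m_la_l},\qquad\theta=e^{2\pi\mathrm i/\rho}.$$ These are the dilaton-shifted modes of the $\mathcal W(\mathfrak{gl}_r)$-algebra in the module twisted by a permutation with cycles of lengths $r_1,\dots,r_d$. *Mode set.* Let $\lambda=\big((\lfloor\frac{r_1}{s_1}\rfloor+1)^{s_1},r_2,\dots,r_{d-1},\lfloor\frac{r_d}{s_d}\rfloor^{s_d}\big)$,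 where exponents denote repetition and the last block is omitted if $r_d=1$, and let $\lambda(i)=\min\{m\ge0:\lambda_1+\cdots+\lambda_m\ge i\}$, with $\lambda(i)=0$ if there is no such $m$. **Proposition.** Suppose that for all $Q_1,\dots,Q_d\in\mathbb C$ and all $t_1,\dots,t_{d-1}\in\mathbb C^*$, and $t_d\in\mathbb C^*$ in case $s_d\ne\infty$, such that $$\sum_{\mu=1}^d Q_\mu=0\qquad\text{and}\qquad t_\mu^{r_\mu}\ne t_\nu^{r_\nu}\ \text{ whenever }\mu\ne\nu\text{ and }(r_\mu,s_\mu)=(r_\nu,s_\nu),$$ the family $H_{i,k}$, with $1\le i\le r$ and $k\ge1-\lambda(i)+\delta_{i,1}$, is an Airy structure. Then * $r_1\equiv-1\bmod s_1$; * $s_\mu\in\{1,2\}$ for all $\mu\notin\{1,d\}$; * $r_d\equiv1\bmod s_d$ (congruence modulo $\infty$ means equality). Moreover, if $d>2$ and $(r_\mu,s_\mu)=(r_\nu,s_\nu)$ for some $\mu\ne\nu$, then $s_\mu=s_\nu=1$. -/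

import Mathlib

open scoped ENNReal Nat

noncomputable section

/-! ## The completed Weyl algebra -/

/-- Generators of the Weyl algebra of a space with linear coordinates `x a`, `a : A`:
`hbarHalf` is the central element `ħ^(1/2)`, `x a` is a coordinate and `dx a` is `ħ ∂_{x a}`.
All generators have degree one. -/
inductive WeylGen (A : Type*) where
  | hbarHalf : WeylGen A
  | x (a : A) : WeylGen A
  | dx (a : A) : WeylGen A

/-- Formal series in normally ordered monomials (powers of `ħ^(1/2)`, then the `x a`, then the
`ħ ∂_{x a}` on the right), given by their coefficients. The ring multiplication that this type
inherits from power series is the *normally ordered* (commutative) product; the product of the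
Weyl algebra is `WeylSeries.star` below. -/
abbrev WeylSeries (A : Type*) : Type _ := MvPowerSeries (WeylGen A) ℂ

namespace WeylSeries

variable {A : Type*}

/-- The element `ħ`. -/
def hbar : WeylSeries A := MvPowerSeries.X WeylGen.hbarHalf ^ 2

/-- The iterated formal derivative `∏_a (∂/∂g_a)^{κ a}` of a series, where `g_a` is the
generator `gen a`. -/
def formalDeriv (gen : A → WeylGen A) (κ : A →₀ ℕ) (F : WeylSeries A) : WeylSeries A :=
  fun u => (κ.prod fun a m => (((u (gen a) + m).descFactorial m : ℕ) : ℂ)) *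
    MvPowerSeries.coeff (u + κ.mapDomain gen) F

/-- The (associative, non-commutative) product of differential operators written in normally
ordered form: `F ⋆ G = ∑_κ (ħ^|κ| / κ!) · (∂^κ F / ∂(ħ∂_x)^κ) · (∂^κ G / ∂x^κ)`. It is the one
determined by `[ħ∂_{x a}, x b] = ħ δ_{a,b}`, all other pairs of generators commuting. On elements
of the completed Weyl algebra every coefficient is a finite sum. -/
def star (F G : WeylSeries A) : WeylSeries A :=
  fun e => ∑ᶠ κ : A →₀ ℕ, (κ.prod fun _ m => ((m ! : ℂ))⁻¹) *
    MvPowerSeries.coeff e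
      (hbar ^ κ.degree * formalDeriv WeylGen.dx κ F * formalDeriv WeylGen.x κ G)

/-- All derivatives that occur in the monomial `e` are with respect to coordinates in `S`. -/
def DerivIn (S : Set A) (e : WeylGen A →₀ ℕ) : Prop :=
  ∀ a, e (WeylGen.dx a) ≠ 0 → a ∈ S

/-- Membership in the completed Weyl algebra of a space whose coordinates are filtered by
`f 0 ⊆ f 1 ⊆ ⋯`: for each `p` only finitely many monomials with derivatives in `f p` occur. -/
def MemCompleted (f : ℕ → Set A) (F : WeylSeries A) : Prop :=
  ∀ p, {e : WeylGen A →₀ ℕ | DerivIn (f p) e ∧ MvPowerSeries.coeff e F ≠ 0}.Finite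

/-- A filtered family of elements of the completed Weyl algebra. -/
def IsFilteredFamily (f : ℕ → Set A) {I : Type*} (D : I → WeylSeries A) : Prop :=
  ∀ p, {q : I × (WeylGen A →₀ ℕ) |
    DerivIn (f p) q.2 ∧ MvPowerSeries.coeff q.2 (D q.1) ≠ 0}.Finite

/-! ## Airy structures -/

open Classical in
/-- Degree one condition: `H a = ħ ∂_{x a} + (terms of degree at least two)` for all `a`. -/
def DegreeOneCondition (H : A → WeylSeries A) : Prop :=
  ∀ (a : A) (e : WeylGen A →₀ ℕ), e.degree < 2 →
    MvPowerSeries.coeff e (H a) = if e = Finsupp.single (WeylGen.dx a) 1 then 1 else 0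

/-- Subalgebra condition: `[H i, H j] = ħ ∑_k c i j k ⋆ H k` for some `c i j k` in the completed
Weyl algebra. The sum over `k` is taken coefficient by coefficient; if `H` is a filtered
family, then only finitely many `k` contribute to a given coefficient. -/
def SubalgebraCondition (f : ℕ → Set A) (H : A → WeylSeries A) : Prop :=
  ∃ c : A → A → A → WeylSeries A,
    (∀ i j k, MemCompleted f (c i j k)) ∧
    ∀ i j e, MvPowerSeries.coeff e (star (H i) (H j) - star (H j) (H i)) =
      ∑ᶠ k, MvPowerSeries.coeff e (hbar * star (c i j k) (H k))

/-- Airy structures in normal form. -/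
def IsAiryNormalForm (f : ℕ → Set A) (H : A → WeylSeries A) : Prop :=
  IsFilteredFamily f H ∧ DegreeOneCondition H ∧ SubalgebraCondition f H

open Classical in
/-- Airy structures, not necessarily in normal form: a filtered family that is brought to normal
form by an invertible (infinite) matrix `N` with inverse `M`. All sums have only finitely many
nonzero terms. -/
def IsAiryStructure (f : ℕ → Set A) {I : Type*} (H : I → WeylSeries A) : Prop :=
  IsFilteredFamily f H ∧
  ∃ (N : A → I → ℂ) (M : I → A → ℂ),
    (∀ i, {a | N a i ≠ 0}.Finite) ∧
    (∀ a, {i | M i a ≠ 0}.Finite) ∧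
    (∀ a b, ∑ᶠ i, N a i * M i b = if a = b then 1 else 0) ∧
    (∀ i j, ∑ᶠ a, M i a * N a j = if i = j then 1 else 0) ∧
    IsAiryNormalForm f (fun a => fun e => ∑ᶠ i, N a i * MvPowerSeries.coeff e (H i))

end WeylSeries

/-! ## Twisted modes of the W-algebra of `gl_r` -/

/-- Labels `(μ, k)` of the coordinates `x^μ_k`, `k > 0`, one family for each of the `d` cycles. -/
abbrev CycleCoord (d : ℕ) : Type := Fin d × ℕ+

/-- The filtration by `k ≤ p`. -/
def cycleFiltration (d : ℕ) (p : ℕ) : Set (CycleCoord d) := {a | (a.2 : ℕ) ≤ p}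

/-- The coefficient `Ψ^(j)_r(a_{2j+1}, …, a_{2j+n})`, a sum over tuples of pairwise distinct
`m_1, …, m_{2j+n}` in `{0, …, r-1}` (numbered from `0` here), with `θ = exp(2πi/r)`. -/
def psiCoeff (r j n : ℕ) (a : Fin n → ℤ) : ℂ :=
  let θ : ℂ := Complex.exp (2 * Real.pi * Complex.I / r)
  (((2 * j + n)! : ℕ) : ℂ)⁻¹ * ∑ m : Fin (2 * j + n) ↪ Fin r,
    (∏ l : Fin j,
      θ ^ ((m ⟨2 * l.1, by have := l.2; omega⟩ : ℕ) + (m ⟨2 * l.1 + 1, by have := l.2; omega⟩ : ℕ)) /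
        (θ ^ (m ⟨2 * l.1 + 1, by have := l.2; omega⟩ : ℕ) -
          θ ^ (m ⟨2 * l.1, by have := l.2; omega⟩ : ℕ)) ^ 2) *
    ∏ l : Fin n, θ ^ (-((m ⟨2 * j + l.1, by have := l.2; omega⟩ : ℕ) : ℤ) * a l)

/-- The differential operators `J^μ_k`: `ħ ∂_{x^μ_k}` for `k > 0`, `ħ^(1/2) Q_μ` for `k = 0`, and
`-k x^μ_{-k}` for `k < 0`. -/
def current {d : ℕ} (Q : Fin d → ℂ) (μ : Fin d) (k : ℤ) : WeylSeries (CycleCoord d) :=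
  if 0 < k then MvPowerSeries.X (WeylGen.dx (μ, k.toNat.toPNat'))
  else if k = 0 then MvPowerSeries.C (Q μ) * MvPowerSeries.X WeylGen.hbarHalf
  else MvPowerSeries.C (-(k : ℂ)) * MvPowerSeries.X (WeylGen.x (μ, (-k).toNat.toPNat'))

open Classical in
/-- The dilaton-shifted operators `J^μ_{-k} - r_μ t_μ δ_{k, s_μ}`; there is no shift if
`s_μ = ∞`. This is the conjugate of `J^μ_{-k}` by
`exp (- ∑_{s_μ ≠ ∞} r_μ t_μ J^μ_{s_μ} / (ħ s_μ))`. -/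
def shiftedCurrent {d : ℕ} (r : Fin d → ℕ) (s : Fin d → ℕ∞) (Q t : Fin d → ℂ)
    (μ : Fin d) (k : ℤ) : WeylSeries (CycleCoord d) :=
  current Q μ k -
    if k < 0 ∧ s μ = ((-k).toNat : ℕ∞) then MvPowerSeries.C ((r μ : ℂ) * t μ) else 0

/-- The mode `W^μ_{i,k}` of a single cycle of length `r μ`, as a function of the operators `J`;
normal ordering is built into the commutative product. Each coefficient is a finite sum. -/
def cycleMode {d : ℕ} (r : Fin d → ℕ) (J : Fin d → ℤ → WeylSeries (CycleCoord d))
    (μ : Fin d) (i : ℕ) (k : ℤ) : WeylSeries (CycleCoord d) :=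
  fun e => (r μ : ℂ)⁻¹ * ∑ j ∈ Finset.range (i / 2 + 1),
    ((i ! : ℂ) / (2 ^ j * (j ! : ℂ) * ((i - 2 * j)! : ℂ))) *
      ∑ᶠ (p : Fin (i - 2 * j) → ℤ) (_ : ∑ l, p l = (r μ : ℤ) * k),
        psiCoeff (r μ) j (i - 2 * j) p *
          MvPowerSeries.coeff e (WeylSeries.hbar ^ j * ∏ l, J μ (p l))

/-- The mode `W_{i,k}` of the W-algebra of `gl_r` in the module twisted by a permutation with
cycles of lengths `r_1, …, r_d`, as a function of the operators `J`. -/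
def twistedMode {d : ℕ} (r : Fin d → ℕ) (J : Fin d → ℤ → WeylSeries (CycleCoord d))
    (i : ℕ) (k : ℤ) : WeylSeries (CycleCoord d) :=
  fun e => ∑ M : Finset (Fin d),
    ∑ ι ∈ (Fintype.piFinset fun μ : M => Finset.Icc 1 (r μ)) with ∑ μ, ι μ = i,
      ∑ᶠ (κ : M → ℤ) (_ : ∑ μ, κ μ = k),
        MvPowerSeries.coeff e
          (∏ μ : M, MvPowerSeries.C (((r μ : ℂ) ^ (ι μ - 1))⁻¹) * cycleMode r J μ (ι μ) (κ μ))

/-- The dilaton-shifted twisted modes `H_{i,k}`. -/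
def shiftedMode {d : ℕ} (r : Fin d → ℕ) (s : Fin d → ℕ∞) (Q t : Fin d → ℂ)
    (i : ℕ) (k : ℤ) : WeylSeries (CycleCoord d) :=
  twistedMode r (shiftedCurrent r s Q t) i k

/-! ## The set of modes -/

/-- The first cycle. -/
def firstCycle {d : ℕ} (hd : 2 ≤ d) : Fin d := ⟨0, by omega⟩

/-- The last cycle. -/
def lastCycle {d : ℕ} (hd : 2 ≤ d) : Fin d := ⟨d - 1, by omega⟩

/-- `⌊r / s⌋`, which is `0` for `s = ∞`. -/
def floorRatio (r : ℕ) (s : ℕ∞) : ℕ := r / s.toNat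

/-- The parts of `λ` that come after the first block: `r_2, …, r_{d-1}`, and then `s_d` times
`⌊r_d / s_d⌋` if `r_d ≠ 1`. (For `s_d = ∞` these last parts are all zero and are omitted.) -/
def tailParts {d : ℕ} (hd : 2 ≤ d) (r : Fin d → ℕ) (s : Fin d → ℕ∞) : List ℕ :=
  List.ofFn (fun j : Fin (d - 2) => r ⟨j.1 + 1, by have := j.2; omega⟩) ++
    if r (lastCycle hd) = 1 then []
    else List.replicate (s (lastCycle hd)).toNat
      (floorRatio (r (lastCycle hd)) (s (lastCycle hd)))

open Classical in
/-- The sequence `λ = ((⌊r_1/s_1⌋+1)^{s_1}, r_2, …, r_{d-1}, ⌊r_d/s_d⌋^{s_d})`, where the last block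
is absent if `r_d = 1`; parts are numbered from `0` and the sequence is continued by zeros. -/
def lamPart {d : ℕ} (hd : 2 ≤ d) (r : Fin d → ℕ) (s : Fin d → ℕ∞) (j : ℕ) : ℕ :=
  if (j : ℕ∞) < s (firstCycle hd) then floorRatio (r (firstCycle hd)) (s (firstCycle hd)) + 1
  else (tailParts hd r s).getD (j - (s (firstCycle hd)).toNat) 0

/-- `λ(i) = min {m ≥ 0 | λ_1 + ⋯ + λ_m ≥ i}` (and `0` if there is no such `m`, which does not
happen if `λ` is a partition of `r_1 + ⋯ + r_d` and `i ≤ r_1 + ⋯ + r_d`). -/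
def lamIndex {d : ℕ} (hd : 2 ≤ d) (r : Fin d → ℕ) (s : Fin d → ℕ∞) (i : ℕ) : ℕ :=
  sInf {m : ℕ | i ≤ ∑ j ∈ Finset.range m, lamPart hd r s j}

/-- The set of all `(i, k)` with `1 ≤ i ≤ r_1 + ⋯ + r_d` and `k ≥ 1 - λ(i) + δ_{i,1}`. -/
def modeSet {d : ℕ} (hd : 2 ≤ d) (r : Fin d → ℕ) (s : Fin d → ℕ∞) : Set (ℕ × ℤ) :=
  {q | 1 ≤ q.1 ∧ q.1 ≤ ∑ μ, r μ ∧
    1 - (lamIndex hd r s q.1 : ℤ) + (if q.1 = 1 then 1 else 0) ≤ q.2}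

/-- Congruence of integers modulo `s`; congruence modulo `∞` is equality. -/
def CongrMod (a b : ℤ) (s : ℕ∞) : Prop :=
  (s = ⊤ → a = b) ∧ ∀ n : ℕ, s = n → a ≡ b [ZMOD n]

end

/-! Only the coefficients of the `ħ∂` in the modes matter, and of these only the supports, for `Q =
0` and one admissible `t`. In an Airy structure the matrix of these coefficients has linearly
independent columns, because multiplication by `N` turns it into the identity.

A linear term of `H_{i,k}` takes `ħ∂_{x_a}` from one current and dilaton shifts from the others. If
cycle `ν` supplies `m_ν` shifts, then `∑ m_ν = i - 1` and `-k = ∑ s_ν m_ν / r_ν - k_a / r_a`, where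
`a` is the `k_a`-th coordinate of a cycle of length `r_a`. As `m_ν ≤ r_ν`, the first sum is at least
the height at `i - 1` of the Newton polygon with slopes `s_ν / r_ν`; let `B(i)` be this height
rounded up within the block of a cycle (`newtonBound`). The columns with `k_a ≤ C r_a` therefore
meet only rows with `B(i) - C ≤ -k < T(i)`, where `T(i) = λ(i) - δ_{i,1}`. For large `C`, counting
columns against rows gives `∑ B ≤ ∑ T` (`sum_newtonBound_le_sum_topExponent`).

Conversely `T ≤ B` holds row by row outside the last cycle and in its first row
(`topExponent_le_newtonBound`), and in sum over the other rows of the last cycle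
(`sum_topExponent_last`). So all these inequalities are equalities. Equality in the rows of the
first cycle gives `s_1 ∣ r_1 + 1`; in the first row of the last cycle it gives `s_μ = 1` for every
middle cycle, more than is claimed; in the remaining rows it gives `s_d ∣ r_d - 1`. Coprimality of
`r_μ` and `s_μ`, needed on the way, follows from the column of `x^μ_1` being nonzero. -/

/-! ## Columns of the linear part of an Airy structure -/

namespace WeylSeries

/-- The columns of the matrix of coefficients of the `ħ ∂_{x a}` in an Airy structure are linearly
independent. -/
theorem IsAiryStructure.eq_zero_of_forall_sum_eq_zero {A I K : Type*} [Fintype K]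
    {f : ℕ → Set A} {H : I → WeylSeries A} (hH : IsAiryStructure f H) (hf : ∀ a, ∃ p, a ∈ f p)
    {g : K → A} (hg : Function.Injective g) {v : K → ℂ}
    (hv : ∀ i, ∑ a, v a * MvPowerSeries.coeff (Finsupp.single (WeylGen.dx (g a)) 1) (H i) = 0) :
    v = 0 := by
  obtain ⟨hfil, N, M, -, -, -, -, -, hdeg, -⟩ := hH
  -- Filteredness makes every column finite, which permits the exchange of the sums over rows and
  -- columns below.
  have hfin : ∀ a : A, {i | MvPowerSeries.coeff (Finsupp.single (WeylGen.dx a) 1) (H i) ≠ 0}.Finite := by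
    intro a
    obtain ⟨p, hp⟩ := hf a
    refine ((hfil p).image Prod.fst).subset ?_
    intro i hi
    refine ⟨(i, Finsupp.single (WeylGen.dx a) 1), ⟨?_, hi⟩, rfl⟩
    intro b hb
    have : b = a := by
      by_contra hne
      apply hb
      rw [Finsupp.single_apply_eq_zero]
      intro h
      injection h with h
      exact absurd h hne
    rwa [this]
  classical
  have hcol : ∀ b a : A,
      ∑ᶠ i, N b i * MvPowerSeries.coeff (Finsupp.single (WeylGen.dx a) 1) (H i) =
        if a = b then 1 else 0 := by
    intro b a
    have h := hdeg b (Finsupp.single (WeylGen.dx a) 1) (by rw [Finsupp.degree_single]; norm_num)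
    refine Eq.trans (Eq.trans ?_ h) ?_
    · rfl
    · refine if_congr ?_ rfl rfl
      constructor
      · intro h
        have := Finsupp.single_left_injective one_ne_zero h
        injection this
      · rintro rfl
        rfl
  funext b
  have h1 : ∑ᶠ i, ∑ a, v a *
      (N (g b) i * MvPowerSeries.coeff (Finsupp.single (WeylGen.dx (g a)) 1) (H i)) = 0 := by
    rw [← finsum_zero (α := I)]
    congr 1
    funext i
    calc _ = N (g b) i *
          ∑ a, v a * MvPowerSeries.coeff (Finsupp.single (WeylGen.dx (g a)) 1) (H i) := by
          rw [Finset.mul_sum]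
          exact Finset.sum_congr rfl fun a _ => by ring
      _ = 0 := by rw [hv, mul_zero]
  rw [finsum_sum_comm] at h1
  · simp only [← mul_finsum, hcol, hg.eq_iff] at h1
    simpa using h1
  · intro a _
    refine (hfin (g a)).subset ?_
    intro i hi h0
    apply hi
    simp [h0]

end WeylSeries

/-! ## Support of the columns -/

theorem MvPowerSeries.exists_of_coeff_single_prod_ne_zero {σ ι R : Type*} [CommSemiring R]
    {s : Finset ι} {F : ι → MvPowerSeries σ R} {g : σ}
    (h : coeff (Finsupp.single g 1) (∏ j ∈ s, F j) ≠ 0) :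
    ∃ j ∈ s, coeff (Finsupp.single g 1) (F j) ≠ 0 ∧ ∀ i ∈ s, i ≠ j → coeff 0 (F i) ≠ 0 := by
  classical
  rw [coeff_prod] at h
  obtain ⟨l, hl, hne⟩ := Finset.exists_ne_zero_of_sum_ne_zero h
  rw [Finset.mem_finsuppAntidiag] at hl
  have hsum : ∑ i ∈ s, l i = Finsupp.single g 1 := hl.1
  have hc : ∀ i ∈ s, coeff (l i) (F i) ≠ 0 := fun i hi h0 => hne (Finset.prod_eq_zero hi h0)
  have hdeg : ∑ i ∈ s, (l i).degree = 1 := by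
    rw [← map_sum, hsum, Finsupp.degree_single]
  obtain ⟨j, hj, hj0⟩ : ∃ j ∈ s, (l j).degree ≠ 0 := by
    apply Finset.exists_ne_zero_of_sum_ne_zero
    rw [hdeg]
    exact one_ne_zero
  have hz : ∀ i ∈ s, i ≠ j → l i = 0 := by
    intro i hi hij
    rw [← Finset.add_sum_erase _ _ hj] at hdeg
    have h1 := Finset.single_le_sum (f := fun i => (l i).degree) (fun _ _ => Nat.zero_le _)
      (Finset.mem_erase.mpr ⟨hij, hi⟩)
    have : (l i).degree = 0 := by
      omega
    exact (Finsupp.degree_eq_zero_iff _).mp this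
  refine ⟨j, hj, ?_, fun i hi hij => ?_⟩
  · rw [← hsum, Finset.sum_eq_single_of_mem j hj hz]
    exact hc j hj
  · rw [← hz i hi hij]
    exact hc i hi

/-- Since `ħ` has degree two, only the `j = 0` terms of `cycleMode` reach the constant and linear
parts. -/
theorem WeylSeries.coeff_hbar_pow_mul_eq_zero {A : Type*} {j : ℕ} (hj : j ≠ 0)
    (F : WeylSeries A) {e : WeylGen A →₀ ℕ} (he : e.degree < 2) :
    MvPowerSeries.coeff e (WeylSeries.hbar ^ j * F) = 0 := by
  classical
  rw [WeylSeries.hbar, ← pow_mul, MvPowerSeries.X_pow_eq, MvPowerSeries.coeff_monomial_mul,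
    if_neg]
  intro h
  have := Finsupp.degree_mono h
  rw [Finsupp.degree_single] at this
  omega

section Support

variable {d : ℕ} {r : Fin d → ℕ} {s : Fin d → ℕ∞} {t : Fin d → ℂ} {μ : Fin d}

theorem coeff_zero_current (k : ℤ) :
    MvPowerSeries.coeff 0 (current (0 : Fin d → ℂ) μ k) = 0 := by
  unfold current
  split_ifs <;> simp

theorem eq_of_coeff_zero_shiftedCurrent_ne_zero {k : ℤ}
    (h : MvPowerSeries.coeff 0 (shiftedCurrent r s 0 t μ k) ≠ 0) :
    ∃ n : ℕ, s μ = n ∧ k = -n := by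
  rw [shiftedCurrent, map_sub, coeff_zero_current, zero_sub, neg_ne_zero] at h
  split_ifs at h with hk
  · exact ⟨_, hk.2, by omega⟩
  · simp at h

theorem eq_of_coeff_dx_shiftedCurrent_ne_zero {a : CycleCoord d} {k : ℤ}
    (h : MvPowerSeries.coeff (Finsupp.single (WeylGen.dx a) 1)
      (shiftedCurrent r s 0 t μ k) ≠ 0) :
    μ = a.1 ∧ k = (a.2 : ℕ) := by
  classical
  have h2 : MvPowerSeries.coeff (Finsupp.single (WeylGen.dx a) 1) (current 0 μ k) ≠ 0 := by
    rw [shiftedCurrent, map_sub] at h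
    intro h0
    rw [h0] at h
    apply h
    split_ifs
    · rw [MvPowerSeries.coeff_C, if_neg (by simp), sub_zero]
    · simp
  unfold current at h2
  split_ifs at h2 with h3 h4
  · rw [MvPowerSeries.coeff_X] at h2
    have h5 : Finsupp.single (WeylGen.dx a) 1 =
        Finsupp.single (WeylGen.dx (μ, k.toNat.toPNat')) 1 := by
      by_contra h6
      simp [h6] at h2
    have h7 := Finsupp.single_left_injective one_ne_zero h5
    injection h7 with h7
    subst h7
    refine ⟨rfl, ?_⟩
    have : 0 < k.toNat := by omega
    simp only [Nat.toPNat'_coe, this, if_true]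
    omega
  · simp at h2
  · rw [MvPowerSeries.coeff_C_mul, MvPowerSeries.coeff_X, if_neg] at h2
    · simp at h2
    · intro h5
      have h7 := Finsupp.single_left_injective one_ne_zero h5
      injection h7

theorem exists_of_coeff_cycleMode_ne_zero {J : Fin d → ℤ → WeylSeries (CycleCoord d)} {i : ℕ}
    {k : ℤ} {e : WeylGen (CycleCoord d) →₀ ℕ} (he : e.degree < 2)
    (h : MvPowerSeries.coeff e (cycleMode r J μ i k) ≠ 0) :
    ∃ p : Fin i → ℤ, ∑ l, p l = r μ * k ∧ MvPowerSeries.coeff e (∏ l, J μ (p l)) ≠ 0 := by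
  have h' : (cycleMode r J μ i k) e ≠ 0 := h
  rw [cycleMode] at h'
  obtain ⟨j, -, hj⟩ := Finset.exists_ne_zero_of_sum_ne_zero (right_ne_zero_of_mul h')
  obtain ⟨p, hp, hp'⟩ := exists_ne_zero_of_finsum_mem_ne_zero (right_ne_zero_of_mul hj)
  have h3 := right_ne_zero_of_mul hp'
  by_cases hj0 : j = 0
  · subst hj0
    exact ⟨p, hp, by simpa using h3⟩
  · exact absurd (WeylSeries.coeff_hbar_pow_mul_eq_zero hj0 _ he) h3

theorem exists_of_coeff_zero_cycleMode_ne_zero {i : ℕ} {k : ℤ} (hi : 1 ≤ i)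
    (h : MvPowerSeries.coeff 0 (cycleMode r (shiftedCurrent r s 0 t) μ i k) ≠ 0) :
    s μ ≠ ⊤ ∧ r μ * k = -((s μ).toNat * i) := by
  obtain ⟨p, hp, hp'⟩ := exists_of_coeff_cycleMode_ne_zero (by simp) h
  rw [MvPowerSeries.coeff_zero_eq_constantCoeff, map_prod, Finset.prod_ne_zero_iff] at hp'
  have h1 := fun l => eq_of_coeff_zero_shiftedCurrent_ne_zero (hp' l (Finset.mem_univ l))
  obtain ⟨n, hn, -⟩ := h1 ⟨0, hi⟩
  have h2 : ∀ l, p l = -((s μ).toNat : ℤ) := by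
    intro l
    obtain ⟨n, hn, h⟩ := h1 l
    rw [h, hn, ENat.toNat_natCast]
  refine ⟨by simp [hn], ?_⟩
  rw [← hp, Finset.sum_congr rfl fun l _ => h2 l]
  simp
  ring

theorem exists_of_coeff_dx_cycleMode_ne_zero {i : ℕ} {k : ℤ} {a : CycleCoord d}
    (h : MvPowerSeries.coeff (Finsupp.single (WeylGen.dx a) 1)
      (cycleMode r (shiftedCurrent r s 0 t) μ i k) ≠ 0) :
    μ = a.1 ∧ (s μ ≠ ⊤ ∨ i = 1) ∧ r μ * k = (a.2 : ℕ) - (s μ).toNat * ((i : ℤ) - 1) := by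
  obtain ⟨p, hp, hp'⟩ := exists_of_coeff_cycleMode_ne_zero
    (by rw [Finsupp.degree_single]; norm_num) h
  obtain ⟨l0, -, hl0, hl⟩ := MvPowerSeries.exists_of_coeff_single_prod_ne_zero hp'
  obtain ⟨h1, h2⟩ := eq_of_coeff_dx_shiftedCurrent_ne_zero hl0
  have h3 := fun l h => eq_of_coeff_zero_shiftedCurrent_ne_zero (hl l (Finset.mem_univ l) h)
  have h4 : ∀ l, l ≠ l0 → p l = -((s μ).toNat : ℤ) := by
    intro l hl
    obtain ⟨n, hn, h⟩ := h3 l hl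
    rw [h, hn, ENat.toNat_natCast]
  refine ⟨h1, ?_, ?_⟩
  · by_cases hall : ∀ l, l = l0
    · right
      have : Fintype.card (Fin i) = 1 := Fintype.card_eq_one_iff.mpr ⟨l0, hall⟩
      simpa using this
    · push Not at hall
      obtain ⟨l, hl⟩ := hall
      obtain ⟨n, hn, -⟩ := h3 l hl
      left
      simp [hn]
  · rw [← hp, ← Finset.add_sum_erase _ _ (Finset.mem_univ l0), h2,
      Finset.sum_congr rfl fun l hl => h4 l (Finset.ne_of_mem_erase hl)]
    have : 1 ≤ i := l0.pos
    simp [Finset.card_erase_of_mem]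
    push_cast [this]
    ring

/-- Support of the linear part of the twisted modes. -/
theorem exists_of_coeff_dx_shiftedMode_ne_zero {i : ℕ} {k : ℤ} {a : CycleCoord d}
    (h : MvPowerSeries.coeff (Finsupp.single (WeylGen.dx a) 1)
      (shiftedMode r s 0 t i k) ≠ 0) :
    ∃ (m : Fin d → ℕ) (κ : Fin d → ℤ), (∀ ν, m ν ≤ r ν) ∧ (∀ ν, m ν ≠ 0 → s ν ≠ ⊤) ∧
      i = ∑ ν, m ν + 1 ∧ k = ∑ ν, κ ν ∧
      ∀ ν, r ν * κ ν = (if ν = a.1 then ((a.2 : ℕ) : ℤ) else 0) - (s ν).toNat * m ν := by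
  have h' : (twistedMode r (shiftedCurrent r s 0 t) i k)
    (Finsupp.single (WeylGen.dx a) 1) ≠ 0 := h
  rw [twistedMode] at h'
  obtain ⟨M, -, hM⟩ := Finset.exists_ne_zero_of_sum_ne_zero h'
  obtain ⟨ι, hι, hιne⟩ := Finset.exists_ne_zero_of_sum_ne_zero hM
  obtain ⟨κ, hκ, hκne⟩ := exists_ne_zero_of_finsum_mem_ne_zero hιne
  rw [Finset.mem_filter, Fintype.mem_piFinset] at hι
  obtain ⟨hι, hιsum⟩ := hι
  replace hκ : ∑ μ, κ μ = k := hκ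
  simp only [Finset.mem_Icc] at hι
  obtain ⟨μ0, -, h0, h1⟩ := MvPowerSeries.exists_of_coeff_single_prod_ne_zero hκne
  rw [MvPowerSeries.coeff_C_mul] at h0
  obtain ⟨hμ0, htop, hr⟩ := exists_of_coeff_dx_cycleMode_ne_zero (right_ne_zero_of_mul h0)
  have h2 : ∀ ν : M, ν ≠ μ0 → s ν ≠ ⊤ ∧ r ν * κ ν = -((s ν).toNat * ι ν) := by
    intro ν hν
    have := h1 ν (Finset.mem_univ _) hν
    rw [MvPowerSeries.coeff_C_mul] at this
    exact exists_of_coeff_zero_cycleMode_ne_zero (hι ν).1 (right_ne_zero_of_mul this)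
  classical
  -- `m ν` counts the dilaton shifts used by the cycle `ν`: all `ι ν` factors, less the one that is
  -- the derivative.
  refine ⟨fun ν => if h : ν ∈ M then ι ⟨ν, h⟩ - (if ν = a.1 then 1 else 0) else 0,
    fun ν => if h : ν ∈ M then κ ⟨ν, h⟩ else 0, ?_, ?_, ?_, ?_, ?_⟩
  · intro ν
    dsimp only
    split_ifs with h h2
    · have := (hι ⟨ν, h⟩).2
      simp only at this
      omega
    · exact (hι ⟨ν, h⟩).2
    · omega
  · intro ν hν
    dsimp only at hν
    split_ifs at hν with h h3
    · rcases htop with h4 | h4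
      · rwa [h3, ← hμ0]
      · exfalso
        apply hν
        have : (⟨ν, h⟩ : M) = μ0 := Subtype.ext (h3.trans hμ0.symm)
        rw [this, h4]
    · refine (h2 ⟨ν, h⟩ ?_).1
      rintro rfl
      exact h3 hμ0
    · exact absurd rfl hν
  · have hx : ∀ ν : M, ι ν =
        (ι ν - (if (ν : Fin d) = a.1 then 1 else 0)) + if ν = μ0 then 1 else 0 := by
      intro ν
      have := (hι ν).1
      have hiff : (ν : Fin d) = a.1 ↔ ν = μ0 := by rw [← hμ0, Subtype.ext_iff]
      simp only [hiff]
      split_ifs <;> omega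
    rw [← hιsum, Finset.sum_congr rfl fun ν _ => hx ν, Finset.sum_add_distrib,
      Finset.sum_ite_eq' Finset.univ μ0, if_pos (Finset.mem_univ _)]
    congr 1
    rw [Finset.sum_dite, Finset.sum_const_zero, add_zero]
    refine Finset.sum_bij (fun ν _ => ⟨ν.1, by simp⟩) ?_ ?_ ?_ ?_
    · simp
    · intro x _ y _ hxy
      ext
      simpa using congrArg (fun z => z.1.val) hxy
    · rintro ⟨b, hb⟩ -
      simp only [Finset.mem_filter] at hb
      exact ⟨⟨b, hb.2⟩, by simp, rfl⟩
    · intro x _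
      rfl
  · rw [← hκ, Finset.sum_dite, Finset.sum_const_zero, add_zero]
    refine Finset.sum_bij (fun ν _ => ⟨ν.1, by simp⟩) ?_ ?_ ?_ ?_
    · simp
    · intro x _ y _ hxy
      ext
      simpa using congrArg (fun z => z.1.val) hxy
    · rintro ⟨b, hb⟩ -
      simp only [Finset.mem_filter] at hb
      exact ⟨⟨b, hb.2⟩, by simp, rfl⟩
    · intro x _
      rfl
  · intro ν
    dsimp only
    by_cases hν : ν ∈ M
    · rw [dif_pos hν, dif_pos hν]
      by_cases h3 : ν = a.1
      · have : (⟨ν, hν⟩ : M) = μ0 := Subtype.ext (h3.trans hμ0.symm)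
        have h5 : ν = μ0 := by rw [← this]
        have h6 := (hι μ0).1
        rw [if_pos h3, if_pos h3, this, h5, hr]
        push_cast [h6]
        ring
      · rw [if_neg h3, if_neg h3, (h2 ⟨ν, hν⟩ ?_).2]
        · simp
        · rintro rfl
          exact h3 hμ0
    · have : ν ≠ a.1 := by
        rintro rfl
        exact hν (hμ0 ▸ μ0.2)
      rw [dif_neg hν, dif_neg hν, if_neg this]
      simp

end Support

/-! ## The counting inequality -/

section Blocks

variable {d : ℕ}

theorem sum_Iio_of_val_eq_succ {M : Type*} [AddCommMonoid M] (f : Fin d → M) {μ ν : Fin d}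
    (h : ν.val = μ.val + 1) :
    ∑ κ ∈ Finset.Iio ν, f κ = ∑ κ ∈ Finset.Iio μ, f κ + f μ := by
  have : Finset.Iio ν = insert μ (Finset.Iio μ) := by
    ext κ
    simp only [Finset.mem_Iio, Finset.mem_insert, Fin.lt_def, Fin.ext_iff]
    omega
  rw [this, Finset.sum_insert (by simp), add_comm]

theorem sum_univ_of_val_succ_eq {M : Type*} [AddCommMonoid M] (f : Fin d → M) {μ : Fin d}
    (h : μ.val + 1 = d) :
    ∑ κ, f κ = ∑ κ ∈ Finset.Iio μ, f κ + f μ := by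
  have : (Finset.univ : Finset (Fin d)) = insert μ (Finset.Iio μ) := by
    ext κ
    have := κ.2
    simp only [Finset.mem_univ, Finset.mem_insert, Finset.mem_Iio, Fin.lt_def, Fin.ext_iff,
      true_iff]
    omega
  rw [this, Finset.sum_insert (by simp), add_comm]

/-- The number `r_1 + ⋯ + r_{μ-1}` of rows that precede those of the cycle `μ`. -/
def rowOffset (r : Fin d → ℕ) (μ : Fin d) : ℕ := ∑ ν ∈ Finset.Iio μ, r ν

theorem exists_eq_rowOffset_add {r : Fin d → ℕ} {i : ℕ} (h1 : 1 ≤ i) (h2 : i ≤ ∑ μ, r μ) :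
    ∃ (μ : Fin d) (l : Fin (r μ)), i = rowOffset r μ + l + 1 := by
  have hd : 0 < d := by
    rcases Nat.eq_zero_or_pos d with rfl | h
    · simp at h2
      omega
    · exact h
  have hne : (Finset.univ.filter fun μ : Fin d => rowOffset r μ < i).Nonempty := by
    refine ⟨⟨0, hd⟩, Finset.mem_filter.mpr ⟨Finset.mem_univ _, ?_⟩⟩
    have : Finset.Iio (⟨0, hd⟩ : Fin d) = ∅ := by
      ext κ
      simp [Fin.lt_def]
    rw [rowOffset, this, Finset.sum_empty]
    omega
  obtain ⟨μ, hμ, hmax⟩ := Finset.exists_max_image _ id hne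
  simp only [Finset.mem_filter, Finset.mem_univ, true_and, id] at hμ hmax
  have key : i ≤ rowOffset r μ + r μ := by
    by_cases h : μ.val + 1 = d
    · rwa [rowOffset, ← sum_univ_of_val_succ_eq r h]
    · by_contra hlt
      have hμd := μ.2
      have h3 := hmax ⟨μ.val + 1, by omega⟩ (by
        rw [rowOffset, sum_Iio_of_val_eq_succ r (μ := μ) rfl]
        simpa [rowOffset] using hlt)
      rw [Fin.le_def] at h3
      simp at h3
  refine ⟨μ, ⟨i - 1 - rowOffset r μ, by omega⟩, ?_⟩
  dsimp only
  omega

/-- The height at row `r_1 + ⋯ + r_{μ-1} + l + 1` of the Newton polygon with slopes `s_μ / r_μ`. -/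
def newtonBound (r s : Fin d → ℕ) (μ : Fin d) (l : ℕ) : ℤ :=
  (∑ ν ∈ Finset.Iio μ, s ν : ℕ) + ⌈(s μ * l : ℚ) / r μ⌉

/-- The slopes `σ` increase, so the weighted sum is least when the cycles are filled in order.
Formally, `(σ ν - σ μ) * m ν` is at least `(σ ν - σ μ) * r ν` for `ν < μ` and nonnegative for `ν ≥
μ`. -/
theorem newton_le_sum {r s : Fin d → ℕ} (hr : ∀ μ, 1 ≤ r μ)
    (hord : ∀ μ ν, μ ≤ ν → s μ * r ν ≤ s ν * r μ) {m : Fin d → ℕ} (hm : ∀ ν, m ν ≤ r ν)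
    {μ : Fin d} {l : ℕ} (hl : ∑ ν, m ν = rowOffset r μ + l) :
    ((∑ ν ∈ Finset.Iio μ, s ν : ℕ) : ℚ) + (s μ * l : ℚ) / r μ ≤ ∑ ν, (s ν : ℚ) * m ν / r ν := by
  have hr' : ∀ μ, (0 : ℚ) < r μ := fun μ => by exact_mod_cast hr μ
  set σ : Fin d → ℚ := fun ν => s ν / r ν with hσ
  have hs : ∀ ν, (s ν : ℚ) = σ ν * r ν := fun ν => by
    rw [hσ]
    field_simp [(hr' ν).ne']
  have hmono : ∀ μ ν, μ ≤ ν → σ μ ≤ σ ν := by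
    intro μ ν h
    rw [hσ]
    simp only
    rw [div_le_div_iff₀ (hr' _) (hr' _)]
    exact_mod_cast hord μ ν h
  have hl' : (l : ℚ) = ∑ ν, (m ν : ℚ) - ∑ ν ∈ Finset.Iio μ, (r ν : ℚ) := by
    rw [rowOffset] at hl
    have : ((∑ ν, m ν : ℕ) : ℚ) = ((∑ ν ∈ Finset.Iio μ, r ν + l : ℕ) : ℚ) := by rw [hl]
    push_cast at this
    linarith
  have h1 : (s μ * l : ℚ) / r μ = σ μ * l := by
    rw [hs]
    field_simp [(hr' μ).ne']
  have h2 : ∀ ν, (s ν : ℚ) * m ν / r ν = σ ν * m ν := fun ν => by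
    rw [hs]
    field_simp [(hr' ν).ne']
  have key : ∑ ν ∈ Finset.Iio μ, (σ ν - σ μ) * r ν ≤ ∑ ν, (σ ν - σ μ) * m ν := by
    rw [← Finset.sum_filter_add_sum_filter_not Finset.univ (fun ν => ν < μ) fun ν =>
      (σ ν - σ μ) * m ν]
    have h3 : Finset.univ.filter (fun ν => ν < μ) = Finset.Iio μ := by
      ext
      simp
    rw [h3]
    have h4 : ∑ ν ∈ Finset.Iio μ, (σ ν - σ μ) * r ν ≤ ∑ ν ∈ Finset.Iio μ, (σ ν - σ μ) * m ν := by
      refine Finset.sum_le_sum fun ν hν => mul_le_mul_of_nonpos_left ?_ ?_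
      · exact_mod_cast hm ν
      · linarith [hmono ν μ (Finset.mem_Iio.mp hν).le]
    have h5 : 0 ≤ ∑ ν with ¬ ν < μ, (σ ν - σ μ) * m ν := by
      refine Finset.sum_nonneg fun ν hν => mul_nonneg ?_ (Nat.cast_nonneg _)
      simp only [Finset.mem_filter, Finset.mem_univ, true_and, not_lt] at hν
      linarith [hmono μ ν hν]
    linarith
  simp only [sub_mul, Finset.sum_sub_distrib, ← Finset.mul_sum] at key
  rw [h1, hl', Finset.sum_congr rfl fun ν _ => h2 ν]
  push_cast
  rw [Finset.sum_congr rfl fun ν _ => hs ν]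
  linarith

end Blocks

/-! ### Rows against columns of the linear part. -/

section Counting

variable {d : ℕ} {hd : 2 ≤ d} {r : Fin d → ℕ} {s : Fin d → ℕ∞} {t : Fin d → ℂ}

/-- The exponent `λ(i) - δ_{i,1}`, so that the mode set consists of all `(i, k)` with
`-k < topExponent i`. -/
noncomputable def topExponent (hd : 2 ≤ d) (r : Fin d → ℕ) (s : Fin d → ℕ∞) (i : ℕ) : ℤ :=
  lamIndex hd r s i - if i = 1 then 1 else 0

/-- A cycle with `s = ∞` supplies no shifts, so its `s'` is multiplied by zero and may be any number
compatible with the ordering of slopes. -/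
theorem newtonBound_sub_le_of_coeff_ne_zero (hr : ∀ μ, 1 ≤ r μ) {s' : Fin d → ℕ}
    (hs' : ∀ μ, s μ ≠ ⊤ → s' μ = (s μ).toNat)
    (hord : ∀ μ ν, μ ≤ ν → s' μ * r ν ≤ s' ν * r μ) {μ : Fin d} {l C : ℕ} {k : ℤ}
    {a : CycleCoord d} (ha : (a.2 : ℕ) ≤ C * r a.1)
    (h : MvPowerSeries.coeff (Finsupp.single (WeylGen.dx a) 1)
      (shiftedMode r s 0 t (rowOffset r μ + l + 1) k) ≠ 0) :
    newtonBound r s' μ l - C ≤ -k := by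
  obtain ⟨m, κ, hm, htop, hi, hk, hκ⟩ := exists_of_coeff_dx_shiftedMode_ne_zero h
  have hr' : ∀ μ, (0 : ℚ) < r μ := fun μ => by exact_mod_cast hr μ
  have h1 := newton_le_sum hr hord hm (μ := μ) (l := l) (by omega)
  have h2 : ∀ ν, (s' ν : ℚ) * m ν / r ν =
      (if ν = a.1 then ((a.2 : ℕ) : ℚ) / r a.1 else 0) - κ ν := by
    intro ν
    have h3 : ((s ν).toNat : ℤ) * m ν = s' ν * m ν := by
      by_cases h0 : m ν = 0
      · simp [h0]
      · rw [hs' ν (htop ν h0)]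
    have h4 := hκ ν
    rw [h3] at h4
    have h5 : (r ν : ℚ) * κ ν = (if ν = a.1 then ((a.2 : ℕ) : ℚ) else 0) - s' ν * m ν := by
      have := congrArg (Int.cast (R := ℚ)) h4
      push_cast at this
      simpa using this
    rw [div_eq_iff (hr' ν).ne']
    split_ifs at h5 ⊢ with h6
    · subst h6
      field_simp [(hr' a.1).ne']
      linarith
    · linarith
  rw [Finset.sum_congr rfl fun ν _ => h2 ν, Finset.sum_sub_distrib,
    Finset.sum_ite_eq' Finset.univ a.1, if_pos (Finset.mem_univ _), ← Int.cast_sum, ← hk] at h1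
  have h3 : ((a.2 : ℕ) : ℚ) / r a.1 ≤ C := by
    rw [div_le_iff₀ (hr' _)]
    exact_mod_cast ha
  have h4 : ⌈(s' μ * l : ℚ) / r μ⌉ ≤ -k + C - (∑ ν ∈ Finset.Iio μ, s' ν : ℕ) := by
    rw [Int.ceil_le]
    push_cast at h1 ⊢
    linarith
  rw [newtonBound]
  linarith

/-- The rows of an Airy structure are at least as many as its columns. -/
theorem sum_newtonBound_le_sum_topExponent (hr : ∀ μ, 1 ≤ r μ) {s' : Fin d → ℕ}
    (hs' : ∀ μ, s μ ≠ ⊤ → s' μ = (s μ).toNat)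
    (hord : ∀ μ ν, μ ≤ ν → s' μ * r ν ≤ s' ν * r μ)
    (hH : WeylSeries.IsAiryStructure (cycleFiltration d)
      (fun q : modeSet hd r s => shiftedMode r s 0 t q.1.1 q.1.2)) :
    ∑ μ, ∑ l ∈ Finset.range (r μ), newtonBound r s' μ l ≤
      ∑ μ, ∑ l ∈ Finset.range (r μ), topExponent hd r s (rowOffset r μ + l + 1) := by
  classical
  set B : (Σ μ, Fin (r μ)) → ℤ := fun x => newtonBound r s' x.1 x.2 with hB
  set T : (Σ μ, Fin (r μ)) → ℤ := fun x => topExponent hd r s (rowOffset r x.1 + x.2 + 1) with hT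
  have hBs : ∑ μ, ∑ l ∈ Finset.range (r μ), newtonBound r s' μ l = ∑ x, B x := by
    rw [Fintype.sum_sigma]
    exact Finset.sum_congr rfl fun μ _ => Finset.sum_range _
  have hTs : ∑ μ, ∑ l ∈ Finset.range (r μ), topExponent hd r s (rowOffset r μ + l + 1) =
      ∑ x, T x := by
    rw [Fintype.sum_sigma]
    exact Finset.sum_congr rfl fun μ _ => Finset.sum_range _
  rw [hBs, hTs]
  by_contra! hlt
  -- With this `C` every interval `[B x - C, T x)` has exactly `T x - B x + C` elements, with no
  -- truncation at zero.
  obtain ⟨C, hC⟩ : ∃ C : ℕ, ∀ x, B x - C ≤ T x := by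
    refine ⟨∑ x, (B x - T x).toNat, fun x => ?_⟩
    have := Finset.single_le_sum (f := fun x => (B x - T x).toNat) (fun _ _ => Nat.zero_le _)
      (Finset.mem_univ x)
    omega
  -- `P` contains all rows of the mode set that can meet the columns selected by `g`.
  set P : Finset (ℕ × ℤ) := Finset.univ.biUnion fun x : Σ μ, Fin (r μ) =>
    (Finset.Ico (B x - C) (T x)).image fun q => (rowOffset r x.1 + x.2 + 1, -q) with hP
  set g : (Σ μ, Fin (C * r μ)) → CycleCoord d := fun a => (a.1, (a.2 : ℕ).succPNat) with hg
  have hginj : Function.Injective g := by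
    rintro ⟨μ, j⟩ ⟨ν, j'⟩ h
    simp only [hg, Prod.mk.injEq, Nat.succPNat_inj] at h
    obtain ⟨rfl, h⟩ := h
    rw [Fin.ext h]
  set h : ℕ × ℤ → (Σ μ, Fin (C * r μ)) → ℂ := fun q a =>
    MvPowerSeries.coeff (Finsupp.single (WeylGen.dx (g a)) 1) (shiftedMode r s 0 t q.1 q.2) with hh
  have hcard : P.card < Fintype.card (Σ μ, Fin (C * r μ)) := by
    have h1 : (P.card : ℤ) ≤ ∑ x, (T x - B x + C) := by
      have h2 : P.card ≤ ∑ x, (Finset.Ico (B x - C) (T x)).card :=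
        Finset.card_biUnion_le.trans (Finset.sum_le_sum fun x _ => Finset.card_image_le)
      calc (P.card : ℤ) ≤ ((∑ x, (Finset.Ico (B x - C) (T x)).card : ℕ) : ℤ) := by exact_mod_cast h2
        _ = ∑ x, (T x - B x + C) := by
          push_cast
          refine Finset.sum_congr rfl fun x _ => ?_
          rw [Int.card_Ico]
          have := hC x
          omega
    rw [Finset.sum_add_distrib, Finset.sum_sub_distrib] at h1
    have h3 : (Fintype.card (Σ μ, Fin (C * r μ)) : ℤ) = ∑ x : (Σ μ, Fin (r μ)), (C : ℤ) := by
      rw [Finset.sum_const, Finset.card_univ, Fintype.card_sigma, Fintype.card_sigma]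
      simp only [Fintype.card_fin]
      rw [← Finset.mul_sum]
      simp [mul_comm]
    have : (P.card : ℤ) < Fintype.card (Σ μ, Fin (C * r μ)) := by
      rw [h3]
      linarith
    exact_mod_cast this
  -- More columns than rows: a nonzero relation exists on `P`, and off `P` the selected columns
  -- vanish on the mode set.
  obtain ⟨v, hv, hv0⟩ := Submodule.exists_mem_ne_zero_of_ne_bot
    (LinearMap.ker_ne_bot_of_finrank_lt
      (f := Matrix.mulVecLin (Matrix.of fun (q : P) a => h q.1 a)) (by simpa using hcard))
  rw [LinearMap.mem_ker, Matrix.mulVecLin_apply] at hv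
  refine hv0 (hH.eq_zero_of_forall_sum_eq_zero (fun a => ⟨a.2, le_refl (a.2 : ℕ)⟩) hginj fun q => ?_)
  obtain ⟨⟨i, k⟩, hi1, hi2, hk⟩ := q
  dsimp only at hi1 hi2 hk ⊢
  by_cases hq : (i, k) ∈ P
  · have h5 := congrFun hv ⟨(i, k), hq⟩
    simp only [Matrix.mulVec, dotProduct, Matrix.of_apply, Pi.zero_apply, hh] at h5
    rw [← h5]
    exact Finset.sum_congr rfl fun a _ => mul_comm _ _
  · refine Finset.sum_eq_zero fun a _ => ?_
    by_contra hne
    apply hq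
    obtain ⟨μ, l, rfl⟩ := exists_eq_rowOffset_add hi1 hi2
    have h6 := newtonBound_sub_le_of_coeff_ne_zero (C := C) hr hs' hord
      (by
        have := a.2.2
        simp only [hg, Nat.succPNat_coe]
        omega) (right_ne_zero_of_mul hne)
    rw [hP, Finset.mem_biUnion]
    refine ⟨⟨μ, l⟩, Finset.mem_univ _, ?_⟩
    rw [Finset.mem_image]
    refine ⟨-k, ?_, by simp⟩
    rw [Finset.mem_Ico]
    refine ⟨h6, ?_⟩
    simp only [hT, topExponent]
    linarith

end Counting

/-! ## Arithmetic of the Newton polygon -/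

section Arithmetic

/-- With `c = r / n + 1` the hypothesis is sharpest at the ends of the blocks of length `c`. Testing
the end of block `n - 1` leaves an excess `n * c - r` of 1 or 2, and 2 would force `n = 2` and `r`
even. -/
theorem dvd_add_one_of_forall_mul_le {r n : ℕ} (hr : 1 ≤ r) (hn : 1 ≤ n) (hco : r.Coprime n)
    (h : ∀ l ≤ r, n * l ≤ r * (l / (r / n + 1) + 1)) : n ∣ r + 1 := by
  set c := r / n + 1 with hc
  obtain ⟨k, rfl⟩ : ∃ k, n = k + 1 := ⟨n - 1, by omega⟩
  rcases Nat.eq_zero_or_pos k with rfl | hk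
  · simp
  have hlt : r < (k + 1) * c := Nat.lt_mul_div_succ r (by omega)
  have hle : (k + 1) * (c - 1) ≤ r := Nat.mul_div_le r (k + 1)
  obtain ⟨b, hb⟩ : ∃ b, c = b + 1 := ⟨r / (k + 1), hc⟩
  rw [hb] at h hlt hle
  simp only [Nat.add_sub_cancel] at hle
  obtain ⟨j, rfl⟩ : ∃ j, k = j + 1 := ⟨k - 1, by omega⟩
  -- Here `n = j + 2` and `c = b + 1`; the test point `c * (j + 1) - 1` is the largest `l` with `l /
  -- c = j`.
  have hl0 : (b + 1) * j + b ≤ r := by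
    by_contra hgt
    have h1 := h r le_rfl
    rw [mul_comm, mul_le_mul_iff_right₀ (by omega)] at h1
    have h2 : j + 1 ≤ r / (b + 1) := by omega
    rw [Nat.le_div_iff_mul_le (by omega)] at h2
    nlinarith
  have h1 := h _ hl0
  have h2 : ((b + 1) * j + b) / (b + 1) = j := by
    rw [Nat.mul_add_div (by omega), Nat.div_eq_of_lt (by omega), add_zero]
  rw [h2] at h1
  obtain ⟨e, he⟩ : ∃ e, (j + 1 + 1) * (b + 1) = r + e := ⟨_, (Nat.add_sub_of_le hlt.le).symm⟩
  have h3 : e * (j + 1) ≤ j + 2 := by nlinarith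
  have he1 : 1 ≤ e := by omega
  have he2 : e ≤ 2 := by nlinarith
  rcases (by omega : e = 1 ∨ e = 2) with rfl | rfl
  · exact ⟨b + 1, by omega⟩
  · have hj : j = 0 := by omega
    subst hj
    exfalso
    have h4 : 2 ∣ r := by omega
    have := Nat.dvd_gcd h4 (dvd_refl 2)
    simp only [Nat.zero_add, Nat.reduceAdd] at hco
    rw [hco.gcd_eq_one] at this
    omega

/-- Pair `l` with `r - l`: the two fractions add up to `n` and, by coprimality, are not integers, so
their ceilings add up to at least `n + 1`. -/
theorem mul_succ_le_two_mul_sum_ceil {r n : ℕ} (hco : r.Coprime n) :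
    ((r - 1 : ℕ) : ℤ) * (n + 1) ≤ 2 * ∑ l ∈ Finset.Ico 1 r, ⌈(n * l : ℚ) / r⌉ := by
  have hrefl : ∑ l ∈ Finset.Ico 1 r, ⌈(n * l : ℚ) / r⌉ =
      ∑ l ∈ Finset.Ico 1 r, ⌈(n * (r - l : ℕ) : ℚ) / r⌉ := by
    refine Finset.sum_nbij' (fun l => r - l) (fun l => r - l) ?_ ?_ ?_ ?_ ?_
    · intro l hl
      simp only [Finset.mem_Ico] at hl ⊢
      omega
    · intro l hl
      simp only [Finset.mem_Ico] at hl ⊢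
      omega
    · intro l hl
      simp only [Finset.mem_Ico] at hl ⊢
      omega
    · intro l hl
      simp only [Finset.mem_Ico] at hl ⊢
      omega
    · intro l hl
      simp only [Finset.mem_Ico] at hl
      rw [Nat.sub_sub_self hl.2.le]
  rw [two_mul]
  nth_rw 2 [hrefl]
  rw [← Finset.sum_add_distrib]
  have h := Finset.card_nsmul_le_sum (Finset.Ico 1 r)
    (fun l => ⌈(n * l : ℚ) / r⌉ + ⌈(n * (r - l : ℕ) : ℚ) / r⌉) ((n : ℤ) + 1) ?_
  · rw [Nat.card_Ico, nsmul_eq_mul] at h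
    exact h
  intro l hl
  rw [Finset.mem_Ico] at hl
  have hr : (r : ℚ) ≠ 0 := by
    have : r ≠ 0 := by omega
    exact_mod_cast this
  have h1 : (n * (r - l : ℕ) : ℚ) / r = n - (n * l : ℚ) / r := by
    rw [Nat.cast_sub hl.2.le]
    field_simp
  have h2 : ⌈(n : ℚ) - (n * l : ℚ) / r⌉ = n - ⌊(n * l : ℚ) / r⌋ := by
    rw [sub_eq_add_neg, Int.ceil_natCast_add, Int.ceil_neg]
    ring
  rw [h1, h2]
  have h3 : ⌊(n * l : ℚ) / r⌋ < ⌈(n * l : ℚ) / r⌉ := by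
    rw [Int.lt_ceil]
    refine lt_of_le_of_ne (Int.floor_le _) fun h => ?_
    rw [eq_div_iff hr] at h
    have h4 : ⌊(n * l : ℚ) / r⌋ * (r : ℤ) = n * l := by exact_mod_cast h
    have h5 : (r : ℤ) ∣ (n * l : ℕ) := ⟨_, by push_cast; rw [← h4, mul_comm]⟩
    have h6 := Nat.le_of_dvd (by omega) (hco.dvd_of_dvd_mul_left (Int.natCast_dvd_natCast.mp h5))
    omega
  linarith

/-- Layer cake estimate for the first passage times of an increasing sequence. -/
theorem two_mul_sum_sub_le {p : ℕ → ℕ} {lam : ℕ → ℕ} {m n f a b : ℕ}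
    (hp : ∀ j ≤ n, p (m + j) = p m + j * f)
    (hlt : ∀ i j, j < lam i → p j < i)
    (hle : ∀ i, lam i ≠ 0 → lam i ≤ m + n ∧ i ≤ p (m + n)) :
    2 * ∑ i ∈ Finset.Ico a b, (lam i - m) ≤ n * (n + 1) * f := by
  -- Each unit of the truncated difference `lam i - m` is a level `j` whose partial sum lies below
  -- `i`. Counting by levels, level `j` occurs for at most `p (m + n) - p (m + j) = (n - j) * f`
  -- values of `i`.
  have h1 : ∀ i, lam i - m ≤
      ∑ j ∈ Finset.range n, if p (m + j) < i ∧ i ≤ p (m + n) then 1 else 0 := by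
    intro i
    rw [← Finset.card_filter]
    have h2 : Finset.range (lam i - m) ⊆
        (Finset.range n).filter fun j => p (m + j) < i ∧ i ≤ p (m + n) := by
      intro j hj
      rw [Finset.mem_range] at hj
      obtain ⟨h3, h4⟩ := hle i (by omega)
      rw [Finset.mem_filter, Finset.mem_range]
      exact ⟨by omega, hlt i _ (by omega), h4⟩
    simpa using Finset.card_le_card h2
  have h2 : ∑ i ∈ Finset.Ico a b, (lam i - m) ≤ ∑ j ∈ Finset.range n, (n - j) * f := by
    refine (Finset.sum_le_sum fun i _ => h1 i).trans ?_
    rw [Finset.sum_comm]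
    refine Finset.sum_le_sum fun j hj => ?_
    rw [Finset.mem_range] at hj
    rw [← Finset.card_filter]
    have h3 : (Finset.Ico a b).filter (fun i => p (m + j) < i ∧ i ≤ p (m + n)) ⊆
        Finset.Ioc (p (m + j)) (p (m + n)) := by
      intro i hi
      rw [Finset.mem_filter] at hi
      exact Finset.mem_Ioc.mpr hi.2
    refine (Finset.card_le_card h3).trans ?_
    rw [Nat.card_Ioc, hp j hj.le, hp n le_rfl, Nat.sub_mul]
    omega
  have h3 : ∑ j ∈ Finset.range n, (n - j) * f = (∑ j ∈ Finset.range (n + 1), j) * f := by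
    rw [← Finset.sum_mul, ← Finset.sum_range_reflect (fun j => j), Finset.sum_range_succ]
    simp
  have h4 := Finset.sum_range_id_mul_two (n + 1)
  simp only [Nat.add_sub_cancel] at h4
  nlinarith

end Arithmetic

/-! ## Partial sums of the sequence of parts -/

section Parts

variable {d : ℕ} {hd : 2 ≤ d} {r : Fin d → ℕ} {s : Fin d → ℕ∞}

/-- The sum of the first `m` parts. -/
noncomputable def partialSum (hd : 2 ≤ d) (r : Fin d → ℕ) (s : Fin d → ℕ∞) (m : ℕ) : ℕ :=
  ∑ j ∈ Finset.range m, lamPart hd r s j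

theorem partialSum_succ (m : ℕ) :
    partialSum hd r s (m + 1) = partialSum hd r s m + lamPart hd r s m :=
  Finset.sum_range_succ _ _

theorem partialSum_mono : Monotone (partialSum hd r s) :=
  monotone_nat_of_le_succ fun m => by
    rw [partialSum_succ]
    omega

theorem lamIndex_le {i m : ℕ} (h : i ≤ partialSum hd r s m) : lamIndex hd r s i ≤ m :=
  Nat.sInf_le h

theorem le_partialSum_lamIndex {i : ℕ} (h : lamIndex hd r s i ≠ 0) :
    i ≤ partialSum hd r s (lamIndex hd r s i) := by
  refine Nat.sInf_mem (s := {m | i ≤ ∑ j ∈ Finset.range m, lamPart hd r s j}) ?_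
  rw [Set.nonempty_iff_ne_empty]
  intro h0
  apply h
  rw [lamIndex, h0, Nat.sInf_empty]

theorem partialSum_lt_of_lt_lamIndex {i j : ℕ} (h : j < lamIndex hd r s i) :
    partialSum hd r s j < i := by
  by_contra h1
  have := lamIndex_le (not_lt.mp h1)
  omega

variable {a : ℕ}

theorem lamPart_of_lt (ha : s (firstCycle hd) = a) {j : ℕ} (hj : j < a) :
    lamPart hd r s j = r (firstCycle hd) / a + 1 := by
  rw [lamPart, if_pos (by rw [ha]; exact_mod_cast hj), floorRatio, ha, ENat.toNat_natCast]

theorem lamPart_add (ha : s (firstCycle hd) = a) (j : ℕ) :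
    lamPart hd r s (a + j) = (tailParts hd r s).getD j 0 := by
  rw [lamPart, if_neg (by rw [ha]; simp), ha, ENat.toNat_natCast, Nat.add_sub_cancel_left]

theorem lamPart_middle (ha : s (firstCycle hd) = a) {m : ℕ} (hm : m + 2 < d) :
    lamPart hd r s (a + m) = r ⟨m + 1, by omega⟩ := by
  have : m < d - 2 := by omega
  rw [lamPart_add ha, tailParts, List.getD_append _ _ _ _ (by simpa using this)]
  rw [List.getD_eq_getElem _ _ (by simpa using this)]
  simp

theorem lamPart_last (ha : s (firstCycle hd) = a) {n : ℕ} (hn : s (lastCycle hd) = n)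
    (hr : r (lastCycle hd) ≠ 1) (j : ℕ) :
    lamPart hd r s (a + (d - 2) + j) = if j < n then r (lastCycle hd) / n else 0 := by
  rw [add_assoc, lamPart_add ha, tailParts, List.getD_append_right _ _ _ _ (by simp), if_neg hr,
    hn, ENat.toNat_natCast, floorRatio, ENat.toNat_natCast]
  simp only [List.length_ofFn, Nat.add_sub_cancel_left]
  split_ifs with h
  · rw [List.getD_eq_getElem _ _ (by simpa using h)]
    simp
  · rw [List.getD_eq_default _ _ (by simpa using h)]

theorem partialSum_of_le (ha : s (firstCycle hd) = a) {m : ℕ} (hm : m ≤ a) :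
    partialSum hd r s m = m * (r (firstCycle hd) / a + 1) := by
  rw [partialSum, Finset.sum_congr rfl fun j hj =>
    lamPart_of_lt ha ((Finset.mem_range.mp hj).trans_le hm)]
  simp

theorem sum_Iio_firstCycle (f : Fin d → ℕ) : ∑ ν ∈ Finset.Iio (firstCycle hd), f ν = 0 := by
  have : Finset.Iio (firstCycle hd) = ∅ := by
    ext κ
    simp [Fin.lt_def, firstCycle]
  rw [this, Finset.sum_empty]

/-- The first block of `λ` sums to more than `r_1`, and each later part up to the last cycle adds
exactly one `r_μ`, so the surplus persists. -/
theorem rowOffset_succ_lt_partialSum (ha : s (firstCycle hd) = a) (ha1 : 1 ≤ a) {m : ℕ}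
    (hm : m + 1 < d) : rowOffset r ⟨m + 1, hm⟩ + 1 ≤ partialSum hd r s (a + m) := by
  induction m with
  | zero =>
    rw [rowOffset, sum_Iio_of_val_eq_succ r (μ := firstCycle hd) (by rfl), sum_Iio_firstCycle,
      add_zero, partialSum_of_le ha le_rfl]
    have := Nat.lt_mul_div_succ (r (firstCycle hd)) (b := a) (by omega)
    omega
  | succ m ih =>
    have h1 := ih (by omega)
    rw [rowOffset, sum_Iio_of_val_eq_succ r (μ := ⟨m + 1, by omega⟩) (by rfl), ← add_assoc,
      partialSum_succ, lamPart_middle ha (by omega)]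
    rw [rowOffset] at h1
    omega

theorem le_sum_Iio_succ {s' : Fin d → ℕ} (hs1 : ∀ μ, 1 ≤ s' μ) (ha : s' (firstCycle hd) = a)
    {m : ℕ} (hm : m + 1 < d) : a + m ≤ ∑ ν ∈ Finset.Iio (⟨m + 1, hm⟩ : Fin d), s' ν := by
  induction m with
  | zero =>
    rw [sum_Iio_of_val_eq_succ s' (μ := firstCycle hd) (by rfl), sum_Iio_firstCycle, ha]
    omega
  | succ m ih =>
    have h1 := ih (by omega)
    rw [sum_Iio_of_val_eq_succ s' (μ := ⟨m + 1, by omega⟩) (by rfl)]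
    have := hs1 ⟨m + 1, by omega⟩
    omega

theorem lamIndex_first_le (ha : s (firstCycle hd) = a) (ha1 : 1 ≤ a) {l : ℕ}
    (hl : l ≤ r (firstCycle hd)) :
    lamIndex hd r s (l + 1) ≤ l / (r (firstCycle hd) / a + 1) + 1 := by
  set c := r (firstCycle hd) / a + 1 with hc
  have hc0 : 0 < c := Nat.succ_pos _
  have h1 : r (firstCycle hd) < a * c := Nat.lt_mul_div_succ _ (by omega)
  have h2 : l / c < a := by
    rw [Nat.div_lt_iff_lt_mul hc0]
    omega
  apply lamIndex_le
  rw [partialSum_of_le ha h2, ← hc, mul_comm]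
  exact Nat.lt_mul_div_succ l hc0

end Parts

/-! ## Comparison of the mode set with the Newton polygon -/

section Comparison

variable {d : ℕ} {hd : 2 ≤ d} {r : Fin d → ℕ} {s : Fin d → ℕ∞} {a : ℕ} {s' : Fin d → ℕ}

theorem firstCycle_or_succ (μ : Fin d) :
    μ = firstCycle hd ∨ ∃ (m : ℕ) (hm : m + 1 < d), μ = ⟨m + 1, hm⟩ := by
  obtain ⟨m, hm⟩ := μ
  cases m with
  | zero => exact Or.inl rfl
  | succ m => exact Or.inr ⟨m, hm, rfl⟩

theorem lastCycle_eq : lastCycle hd = ⟨d - 2 + 1, by omega⟩ := by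
  rw [lastCycle, Fin.mk.injEq]
  omega

theorem newtonBound_zero (μ : Fin d) :
    newtonBound r s' μ 0 = (∑ ν ∈ Finset.Iio μ, s' ν : ℕ) := by
  simp [newtonBound]

theorem topExponent_le (i : ℕ) : topExponent hd r s i ≤ lamIndex hd r s i := by
  rw [topExponent]
  split_ifs <;> omega

theorem one_le_ceil {n l r : ℕ} (hn : 1 ≤ n) (hl : 1 ≤ l) (hr : 1 ≤ r) :
    1 ≤ ⌈(n * l : ℚ) / r⌉ := by
  rw [Int.one_le_ceil_iff]
  have h1 : (0 : ℚ) < n := by exact_mod_cast hn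
  have h2 : (0 : ℚ) < l := by exact_mod_cast hl
  have h3 : (0 : ℚ) < r := by exact_mod_cast hr
  positivity

/-- In the first cycle, with `c = r_1 / s_1 + 1`, the bound `r_1 < s_1 * c` puts `l / c` strictly
below `s_1 * l / r_1` for `l > 0`; row 1 needs the correction `δ_{i,1}`. In later cycles each
preceding `s'` is at least 1, while `λ` spends a single part on each middle cycle. -/
theorem topExponent_le_newtonBound (hr : ∀ μ, 1 ≤ r μ) (ha : s (firstCycle hd) = a)
    (ha1 : 1 ≤ a) (hs1 : ∀ μ, 1 ≤ s' μ) (ha' : s' (firstCycle hd) = a) {μ : Fin d} {l : ℕ}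
    (hl : l < r μ) (hμ : μ ≠ lastCycle hd ∨ l = 0) :
    topExponent hd r s (rowOffset r μ + l + 1) ≤ newtonBound r s' μ l := by
  rcases firstCycle_or_succ (hd := hd) μ with rfl | ⟨m, hm, rfl⟩
  · rw [rowOffset, sum_Iio_firstCycle, zero_add]
    have h1 := lamIndex_first_le ha ha1 (l := l) hl.le
    rcases Nat.eq_zero_or_pos l with rfl | hl0
    · rw [newtonBound_zero, sum_Iio_firstCycle, topExponent]
      simp only [Nat.zero_div, zero_add] at h1
      simp only [zero_add, if_true]
      omega
    · rw [newtonBound, sum_Iio_firstCycle, ha']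
      refine (topExponent_le _).trans ?_
      set c := r (firstCycle hd) / a + 1
      have h2 : ((l / c : ℕ) : ℤ) < ⌈(a * l : ℚ) / r (firstCycle hd)⌉ := by
        rw [Int.lt_ceil, lt_div_iff₀ (by exact_mod_cast hr _)]
        have h3 : l / c * r (firstCycle hd) < a * l := by
          have h4 : r (firstCycle hd) < a * c := Nat.lt_mul_div_succ _ (by omega)
          have h5 : l / c * c ≤ l := Nat.div_mul_le_self l c
          rcases Nat.eq_zero_or_pos (l / c) with h6 | h6
          · rw [h6, zero_mul]
            positivity
          · calc l / c * r (firstCycle hd) < l / c * (a * c) := by gcongr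
              _ = a * (l / c * c) := by ring
              _ ≤ a * l := by gcongr
        exact_mod_cast h3
      push_cast
      omega
  · refine (topExponent_le _).trans ?_
    have h1 := rowOffset_succ_lt_partialSum (r := r) ha ha1 hm
    have h2 := le_sum_Iio_succ hs1 ha' hm
    rcases Nat.eq_zero_or_pos l with rfl | hl0
    · rw [newtonBound_zero, add_zero]
      exact_mod_cast (lamIndex_le h1).trans h2
    · have h3 : m + 2 < d := by
        rcases hμ with h | h
        · rw [lastCycle, Ne, Fin.mk.injEq] at h
          omega
        · omega
      have h4 : lamIndex hd r s (rowOffset r ⟨m + 1, hm⟩ + l + 1) ≤ a + m + 1 := by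
        apply lamIndex_le
        rw [partialSum_succ, lamPart_middle ha h3]
        omega
      have h5 := one_le_ceil (hs1 ⟨m + 1, hm⟩) hl0 (hr ⟨m + 1, hm⟩)
      rw [newtonBound]
      omega

/-- In the rows of the last cycle, the mode set is bounded by the Newton polygon on average, with
equality only if `r ≡ 1` modulo `s`. -/
theorem sum_topExponent_last (ha : s (firstCycle hd) = a) (ha1 : 1 ≤ a)
    (hs1 : ∀ μ, 1 ≤ s' μ) (ha' : s' (firstCycle hd) = a) (hr : 2 ≤ r (lastCycle hd))
    (hn : s (lastCycle hd) = s' (lastCycle hd))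
    (hco : (r (lastCycle hd)).Coprime (s' (lastCycle hd))) :
    ∑ l ∈ Finset.Ico 1 (r (lastCycle hd)),
        topExponent hd r s (rowOffset r (lastCycle hd) + l + 1) ≤
      ∑ l ∈ Finset.Ico 1 (r (lastCycle hd)), newtonBound r s' (lastCycle hd) l ∧
    (∑ l ∈ Finset.Ico 1 (r (lastCycle hd)),
        topExponent hd r s (rowOffset r (lastCycle hd) + l + 1) =
      ∑ l ∈ Finset.Ico 1 (r (lastCycle hd)), newtonBound r s' (lastCycle hd) l →
      s' (lastCycle hd) ∣ r (lastCycle hd) - 1) := by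
  have hn1 := hs1 (lastCycle hd)
  have hR : rowOffset r (lastCycle hd) + 1 ≤ partialSum hd r s (a + (d - 2)) := by
    rw [lastCycle_eq]
    exact rowOffset_succ_lt_partialSum ha ha1 _
  have hS : a + (d - 2) ≤ ∑ ν ∈ Finset.Iio (lastCycle hd), s' ν := by
    rw [lastCycle_eq]
    exact le_sum_Iio_succ hs1 ha' _
  set ρ := r (lastCycle hd) with hρ
  set n := s' (lastCycle hd) with hnn
  set R := rowOffset r (lastCycle hd)
  set S := ∑ ν ∈ Finset.Iio (lastCycle hd), s' ν with hSdef
  set m := a + (d - 2) with hm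
  have hpart : ∀ j, lamPart hd r s (m + j) = if j < n then ρ / n else 0 :=
    lamPart_last ha hn (by omega)
  have hB : ∑ l ∈ Finset.Ico 1 ρ, newtonBound r s' (lastCycle hd) l =
      ((ρ - 1 : ℕ) : ℤ) * S + ∑ l ∈ Finset.Ico 1 ρ, ⌈(n * l : ℚ) / ρ⌉ := by
    simp only [newtonBound, Finset.sum_add_distrib, Finset.sum_const, Nat.card_Ico, nsmul_eq_mul]
    rfl
  have hceil := mul_succ_le_two_mul_sum_ceil hco
  -- For `n = 1` the estimate `n * (ρ / n) ≤ ρ - 1` used below fails, but the comparison then holds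
  -- row by row.
  rcases (by omega : n = 1 ∨ 2 ≤ n) with h1 | h2
  · refine ⟨Finset.sum_le_sum fun l hl => ?_, fun _ => by rw [h1]; exact one_dvd _⟩
    rw [Finset.mem_Ico] at hl
    have h3 : lamIndex hd r s (R + l + 1) ≤ m + 1 := by
      apply lamIndex_le
      have := hpart 0
      rw [h1, if_pos one_pos, Nat.div_one, add_zero] at this
      rw [partialSum_succ, this]
      omega
    have h4 := one_le_ceil hn1 hl.1 (by omega : 1 ≤ ρ)
    refine (topExponent_le _).trans ?_
    have h5 : newtonBound r s' (lastCycle hd) l = S + ⌈(n * l : ℚ) / ρ⌉ := rfl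
    rw [h5]
    omega
  · have hp : ∀ j ≤ n, partialSum hd r s (m + j) = partialSum hd r s m + j * (ρ / n) := by
      intro j hj
      induction j with
      | zero => simp
      | succ j ih =>
        rw [← add_assoc, partialSum_succ, ih (by omega), hpart, if_pos (by omega)]
        ring
    have hp' : ∀ j, partialSum hd r s (m + n + j) = partialSum hd r s (m + n) := by
      intro j
      induction j with
      | zero => rfl
      | succ j ih =>
        rw [← add_assoc, partialSum_succ, ih, add_assoc m n j, hpart, if_neg (by omega), add_zero]
    have hle : ∀ i, lamIndex hd r s i ≠ 0 →
        lamIndex hd r s i ≤ m + n ∧ i ≤ partialSum hd r s (m + n) := by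
      intro i hi
      have h3 := le_partialSum_lamIndex hi
      have h4 : i ≤ partialSum hd r s (m + n) := by
        rw [← hp' (lamIndex hd r s i)]
        exact h3.trans (partialSum_mono (by omega))
      exact ⟨lamIndex_le h4, h4⟩
    have hcake := two_mul_sum_sub_le (a := 1 + (R + 1)) (b := ρ + (R + 1)) hp
      (fun i j => partialSum_lt_of_lt_lamIndex) hle
    rw [← Finset.sum_Ico_add] at hcake
    have hT : ∑ l ∈ Finset.Ico 1 ρ, topExponent hd r s (R + l + 1) ≤
        ((∑ l ∈ Finset.Ico 1 ρ, (lamIndex hd r s (R + 1 + l) - m) : ℕ) : ℤ) +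
          ((ρ - 1 : ℕ) : ℤ) * m := by
      have h3 : ((ρ - 1 : ℕ) : ℤ) * m = ∑ l ∈ Finset.Ico 1 ρ, (m : ℤ) := by simp
      rw [h3, Nat.cast_sum, ← Finset.sum_add_distrib]
      refine Finset.sum_le_sum fun l _ => ?_
      refine (topExponent_le _).trans ?_
      rw [(by ring : R + l + 1 = R + 1 + l)]
      omega
    have hdiv : n * (ρ / n) + 1 ≤ ρ := by
      rcases (Nat.mul_div_le ρ n).lt_or_eq with h | h
      · omega
      · exfalso
        have h3 : n ∣ ρ := ⟨_, h.symm⟩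
        have h4 := Nat.dvd_gcd h3 (dvd_refl n)
        rw [hco.gcd_eq_one] at h4
        have := Nat.le_of_dvd one_pos h4
        omega
    obtain ⟨q, hq⟩ : ∃ q, q = ρ / n := ⟨_, rfl⟩
    rw [← hq] at hcake hdiv
    obtain ⟨ρ', hρ'⟩ : ∃ ρ', ρ = ρ' + 1 := ⟨ρ - 1, by omega⟩
    have hρ1 : ρ - 1 = ρ' := by omega
    rw [hρ1] at hB hceil hT ⊢
    have hcake' : 2 * ((∑ l ∈ Finset.Ico 1 ρ, (lamIndex hd r s (R + 1 + l) - m) : ℕ) : ℤ) ≤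
        n * (n + 1) * q := by exact_mod_cast hcake
    have hdiv' : (n : ℤ) * q ≤ ρ' := by
      have : n * q ≤ ρ' := by omega
      exact_mod_cast this
    have hSm : ((ρ' : ℕ) : ℤ) * m ≤ ρ' * S := by
      have : (m : ℤ) ≤ S := by exact_mod_cast hS
      gcongr
    have hprod : ((n : ℤ) * q) * (n + 1) ≤ ρ' * (n + 1) := by gcongr
    have hring : (n : ℤ) * (n + 1) * q = ((n : ℤ) * q) * (n + 1) := by ring
    refine ⟨by linarith, fun heq => ?_⟩
    -- Equality at the two ends forces it throughout the chain `n * (n + 1) * q ≤ ρ' * (n + 1) ≤ 2 *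
    -- ∑ ⌈n * l / ρ⌉`.
    have h5 : ((ρ' : ℕ) : ℤ) * (n + 1) ≤ ((n : ℤ) * q) * (n + 1) := by linarith
    have h6 : (ρ' : ℤ) ≤ n * q := le_of_mul_le_mul_right h5 (by positivity)
    have h7 : ρ' = n * q := by
      have : ρ' ≤ n * q := by exact_mod_cast h6
      omega
    exact ⟨q, h7⟩

end Comparison

/-! ## Conditions on the cycles -/

section Conditions

variable {d : ℕ} {hd : 2 ≤ d} {r : Fin d → ℕ} {s : Fin d → ℕ∞} {t : Fin d → ℂ}

/-- A nonzero entry in the column of `x^μ_1` gives `r μ * κ + s μ * m = 1`, a Bézout relation. If `s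
μ = ⊤`, then `toNat` is 0 and the conclusion means `r μ = 1`. -/
theorem coprime_of_isAiryStructure
    (hH : WeylSeries.IsAiryStructure (cycleFiltration d)
      (fun q : modeSet hd r s => shiftedMode r s 0 t q.1.1 q.1.2)) (μ : Fin d) :
    (r μ).Coprime (s μ).toNat := by
  obtain ⟨q, hq⟩ : ∃ q : modeSet hd r s, MvPowerSeries.coeff
      (Finsupp.single (WeylGen.dx ((μ, 1) : CycleCoord d)) 1)
      (shiftedMode r s 0 t q.1.1 q.1.2) ≠ 0 := by
    by_contra! h
    have h1 := hH.eq_zero_of_forall_sum_eq_zero (fun a => ⟨a.2, le_refl (a.2 : ℕ)⟩)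
      (K := Unit) (g := fun _ => (μ, 1)) (fun _ _ _ => rfl) (v := 1) (fun q => by simp [h q])
    exact one_ne_zero h1
  obtain ⟨m, κ, -, -, -, -, hκ⟩ := exists_of_coeff_dx_shiftedMode_ne_zero hq
  have h := hκ μ
  simp only [if_true, PNat.one_coe, Nat.cast_one] at h
  rw [← Nat.isCoprime_iff_coprime]
  exact ⟨κ μ, m μ, by linarith⟩

/-- Infinite `s μ` become `r μ * k`: all get the common slope `k`, steeper than every finite one.
The parameter `K` makes them as large as desired. -/
theorem exists_finite_slopes (hr : ∀ μ, 1 ≤ r μ) (hs : ∀ μ, 1 ≤ s μ)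
    (hord : Antitone fun μ => (r μ : ℝ≥0∞) / (s μ : ℝ≥0∞)) (K : ℕ) :
    ∃ s' : Fin d → ℕ, (∀ μ, s μ ≠ ⊤ → s' μ = (s μ).toNat) ∧ (∀ μ, 1 ≤ s' μ) ∧
      (∀ μ ν, μ ≤ ν → s' μ * r ν ≤ s' ν * r μ) ∧ ∀ μ, s μ = ⊤ → K ≤ s' μ := by
  classical
  set k : ℕ := K + 1 + ∑ μ, (s μ).toNat with hk
  have hpos : ∀ μ, s μ ≠ ⊤ → 1 ≤ (s μ).toNat := by
    intro μ h
    have := hs μ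
    rw [← ENat.natCast_toNat h] at this
    exact_mod_cast this
  refine ⟨fun μ => if s μ = ⊤ then r μ * k else (s μ).toNat, ?_, ?_, ?_, ?_⟩
  · intro μ h
    simp [h]
  · intro μ
    dsimp only
    split_ifs with h
    · exact Nat.mul_pos (hr μ) (by omega)
    · exact hpos μ h
  · intro μ ν hμν
    have h1 : (r ν : ℝ≥0∞) / (s ν : ℝ≥0∞) ≤ (r μ : ℝ≥0∞) / (s μ : ℝ≥0∞) := hord hμν
    dsimp only
    split_ifs with h2 h3 h3
    · exact (by ring : r μ * k * r ν = r ν * k * r μ).le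
    · exfalso
      rw [h2, ← ENat.natCast_toNat h3] at h1
      simp only [ENat.toENNReal_top, ENNReal.div_top, nonpos_iff_eq_zero, ENNReal.div_eq_zero_iff,
        Nat.cast_eq_zero, ENat.toENNReal_coe, ENNReal.natCast_ne_top, or_false] at h1
      have := hr ν
      omega
    · have h4 : (s μ).toNat ≤ k := by
        have := Finset.single_le_sum (f := fun μ => (s μ).toNat) (fun _ _ => Nat.zero_le _)
          (Finset.mem_univ μ)
        omega
      have h5 := hr μ
      calc (s μ).toNat * r ν ≤ k * r ν := by gcongr
        _ = r ν * k * 1 := by ring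
        _ ≤ r ν * k * r μ := by gcongr
    · rw [← ENat.natCast_toNat h2, ← ENat.natCast_toNat h3] at h1
      simp only [ENat.toENNReal_coe] at h1
      have h4 := hpos μ h2
      have h5 := hpos ν h3
      have h4' : ((s μ).toNat : ℝ≥0∞) ≠ 0 := by
        rw [Nat.cast_ne_zero]
        omega
      have h5' : ((s ν).toNat : ℝ≥0∞) ≠ 0 := by
        rw [Nat.cast_ne_zero]
        omega
      rw [ENNReal.div_le_iff h5' (ENNReal.natCast_ne_top _)] at h1
      have h6 : (r ν : ℝ≥0∞) * (s μ).toNat ≤ r μ * (s ν).toNat := by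
        calc _ ≤ (r μ : ℝ≥0∞) / (s μ).toNat * (s ν).toNat * (s μ).toNat := by gcongr
          _ = (r μ : ℝ≥0∞) / (s μ).toNat * (s μ).toNat * (s ν).toNat := by ring
          _ = _ := by rw [ENNReal.div_mul_cancel h4' (ENNReal.natCast_ne_top _)]
      have h7 : r ν * (s μ).toNat ≤ r μ * (s ν).toNat := by exact_mod_cast h6
      rw [mul_comm _ (r ν), mul_comm _ (r μ)]
      exact h7
  · intro μ h
    simp only [h, if_true]
    have := hr μ
    calc K ≤ 1 * k := by omega
      _ ≤ r μ * k := by gcongr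

/-- An infinite `s μ` before the last cycle may be replaced by arbitrarily large numbers, which
makes the Newton side of the counting inequality unbounded while the mode side stays fixed. -/
theorem ne_top_of_isAiryStructure (hr : ∀ μ, 1 ≤ r μ) (hs : ∀ μ, 1 ≤ s μ)
    (hord : Antitone fun μ => (r μ : ℝ≥0∞) / (s μ : ℝ≥0∞))
    (hH : WeylSeries.IsAiryStructure (cycleFiltration d)
      (fun q : modeSet hd r s => shiftedMode r s 0 t q.1.1 q.1.2)) {μ : Fin d}
    (hμ : μ ≠ lastCycle hd) : s μ ≠ ⊤ := by
  intro htop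
  set T := ∑ μ, ∑ l ∈ Finset.range (r μ), topExponent hd r s (rowOffset r μ + l + 1) with hT
  obtain ⟨s', hs', -, hord', hK⟩ := exists_finite_slopes hr hs hord (T.toNat + 1)
  have h1 := sum_newtonBound_le_sum_topExponent hr hs' hord' hH
  rw [← hT] at h1
  have hnonneg : ∀ ν l, 0 ≤ newtonBound r s' ν l := fun ν l => by
    have : 0 ≤ ⌈(s' ν * l : ℚ) / r ν⌉ := Int.ceil_nonneg (by positivity)
    rw [newtonBound]
    omega
  have h2 : newtonBound r s' (lastCycle hd) 0 ≤
      ∑ μ, ∑ l ∈ Finset.range (r μ), newtonBound r s' μ l :=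
    (Finset.single_le_sum (f := fun l => newtonBound r s' (lastCycle hd) l)
      (fun l _ => hnonneg _ l) (Finset.mem_range.mpr (hr (lastCycle hd)))).trans
    (Finset.single_le_sum
      (f := fun μ => ∑ l ∈ Finset.range (r μ), newtonBound r s' μ l)
      (fun ν _ => Finset.sum_nonneg fun l _ => hnonneg ν l) (Finset.mem_univ (lastCycle hd)))
  rw [newtonBound_zero] at h2
  have h3 : s' μ ≤ ∑ ν ∈ Finset.Iio (lastCycle hd), s' ν := by
    refine Finset.single_le_sum (f := s') (fun _ _ => Nat.zero_le _) ?_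
    rw [Finset.mem_Iio, Fin.lt_def]
    have h4 : μ.val ≠ d - 1 := fun h => hμ (Fin.ext h)
    have := μ.2
    simp only [lastCycle]
    omega
  have h4 := hK μ htop
  omega

end Conditions

/-! ### The squeeze and its equality cases. -/

theorem mainTheorem6 (d : ℕ) (hd : 2 ≤ d)
    (r : Fin d → ℕ) (hr : ∀ μ, 1 ≤ r μ)
    (s : Fin d → ℕ∞) (hs : ∀ μ, 1 ≤ s μ)
    (hord : Antitone fun μ => (r μ : ℝ≥0∞) / (s μ : ℝ≥0∞))
    (hAiry : ∀ Q t : Fin d → ℂ,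
      (∀ μ, (μ ≠ lastCycle hd ∨ s μ ≠ ⊤) → t μ ≠ 0) →
      ∑ μ, Q μ = 0 →
      (∀ μ ν, μ ≠ ν → r μ = r ν → s μ = s ν → t μ ^ r μ ≠ t ν ^ r ν) →
      WeylSeries.IsAiryStructure (cycleFiltration d)
        (fun q : modeSet hd r s => shiftedMode r s Q t q.1.1 q.1.2)) :
    (CongrMod (r (firstCycle hd)) (-1) (s (firstCycle hd)) ∧
      (∀ μ, μ ≠ firstCycle hd → μ ≠ lastCycle hd → s μ = 1 ∨ s μ = 2) ∧
      CongrMod (r (lastCycle hd)) 1 (s (lastCycle hd))) ∧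
    (2 < d → ∀ μ ν, μ ≠ ν → r μ = r ν → s μ = s ν → s μ = 1 ∧ s ν = 1) := by
  -- Distinct positive integers `t μ = μ + 1` have distinct powers of equal exponent, so this choice
  -- is admissible.
  have hH := hAiry 0 (fun μ => ((μ.val + 1 : ℕ) : ℂ)) (fun μ _ => Nat.cast_ne_zero.mpr (by omega))
    (by simp) (by
      intro μ ν hne hrr _ h
      rw [hrr, ← Nat.cast_pow, ← Nat.cast_pow, Nat.cast_inj] at h
      have h1 := Nat.pow_left_injective (Nat.one_le_iff_ne_zero.mp (hr ν)) h
      exact hne (Fin.ext (by simpa using h1)))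
  have hco := coprime_of_isAiryStructure hH
  have htop : ∀ μ, μ ≠ lastCycle hd → s μ ≠ ⊤ :=
    fun μ hμ => ne_top_of_isAiryStructure hr hs hord hH hμ
  have hfl : firstCycle hd ≠ lastCycle hd := by
    rw [firstCycle, lastCycle, Ne, Fin.mk.injEq]
    omega
  obtain ⟨s', hs', hs1, hord', -⟩ := exists_finite_slopes hr hs hord 0
  have hcast : ∀ μ, s μ ≠ ⊤ → s μ = s' μ := fun μ h => by rw [hs' μ h, ENat.natCast_toNat h]
  have hco' : ∀ μ, s μ ≠ ⊤ → (r μ).Coprime (s' μ) := fun μ h => by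
    rw [hs' μ h]
    exact hco μ
  have ha := hcast _ (htop _ hfl)
  have ha1 := hs1 (firstCycle hd)
  have hsum := sum_newtonBound_le_sum_topExponent hr hs' hord' hH
  have hpt := fun (μ : Fin d) (l : ℕ) => topExponent_le_newtonBound (μ := μ) (l := l) hr ha ha1 hs1 rfl
  have hr1 : s (lastCycle hd) = ⊤ → r (lastCycle hd) = 1 := by
    intro h
    have := hco (lastCycle hd)
    rwa [h, ENat.toNat_top, Nat.coprime_zero_right] at this
  have hrange : ∀ f : ℕ → ℤ, ∑ l ∈ Finset.range (r (lastCycle hd)), f l =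
      f 0 + ∑ l ∈ Finset.Ico 1 (r (lastCycle hd)), f l := by
    intro f
    rw [Finset.range_eq_Ico, Finset.sum_eq_sum_Ico_succ_bot (hr _)]
  have hlast : ∑ l ∈ Finset.Ico 1 (r (lastCycle hd)),
        topExponent hd r s (rowOffset r (lastCycle hd) + l + 1) ≤
      ∑ l ∈ Finset.Ico 1 (r (lastCycle hd)), newtonBound r s' (lastCycle hd) l ∧
      (∑ l ∈ Finset.Ico 1 (r (lastCycle hd)),
        topExponent hd r s (rowOffset r (lastCycle hd) + l + 1) =
      ∑ l ∈ Finset.Ico 1 (r (lastCycle hd)), newtonBound r s' (lastCycle hd) l →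
      s' (lastCycle hd) ∣ r (lastCycle hd) - 1) := by
    rcases (hr (lastCycle hd)).eq_or_lt with h | h
    · rw [← h]
      simp
    · have h1 : s (lastCycle hd) ≠ ⊤ := fun h2 => by
        have := hr1 h2
        omega
      exact sum_topExponent_last ha ha1 hs1 rfl h (hcast _ h1) (hco' _ h1)
  have hblock : ∀ μ ∈ Finset.univ,
      ∑ l ∈ Finset.range (r μ), topExponent hd r s (rowOffset r μ + l + 1) ≤
        ∑ l ∈ Finset.range (r μ), newtonBound r s' μ l := by
    intro μ _
    by_cases h : μ = lastCycle hd
    · subst h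
      rw [hrange, hrange]
      exact add_le_add (hpt _ 0 (hr _) (Or.inr rfl)) hlast.1
    · exact Finset.sum_le_sum fun l hl => hpt μ l (Finset.mem_range.mp hl) (Or.inl h)
  have hblock' := (Finset.sum_eq_sum_iff_of_le hblock).mp
    (le_antisymm (Finset.sum_le_sum hblock) hsum)
  have heq_last := hblock' (lastCycle hd) (Finset.mem_univ _)
  rw [hrange, hrange] at heq_last
  have heq_last0 := hpt (lastCycle hd) 0 (hr _) (Or.inr rfl)
  have hdvd := hlast.2 (le_antisymm hlast.1 (by linarith))
  have heq : ∀ μ l, l < r μ → (μ ≠ lastCycle hd ∨ l = 0) →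
      topExponent hd r s (rowOffset r μ + l + 1) = newtonBound r s' μ l := by
    intro μ l hl hμ
    by_cases h : μ = lastCycle hd
    · subst h
      obtain rfl : l = 0 := by simpa using hμ
      exact le_antisymm heq_last0 (by linarith [hlast.1])
    · exact (Finset.sum_eq_sum_iff_of_le fun l hl =>
        hpt μ l (Finset.mem_range.mp hl) (Or.inl h)).mp (hblock' μ (Finset.mem_univ _)) l
        (Finset.mem_range.mpr hl)
  have hfirst : s' (firstCycle hd) ∣ r (firstCycle hd) + 1 := by
    refine dvd_add_one_of_forall_mul_le (hr _) ha1 (hco' _ (htop _ hfl)) fun l hl => ?_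
    have h1 := lamIndex_first_le ha ha1 hl
    rcases Nat.eq_zero_or_pos l with rfl | hl0
    · simp
    rcases hl.lt_or_eq with hlt | rfl
    · have h2 := heq _ l hlt (Or.inl hfl)
      rw [rowOffset, sum_Iio_firstCycle, zero_add, newtonBound, sum_Iio_firstCycle] at h2
      have h3 : ⌈(s' (firstCycle hd) * l : ℚ) / r (firstCycle hd)⌉ ≤
          ((l / (r (firstCycle hd) / s' (firstCycle hd) + 1) + 1 : ℕ) : ℤ) := by
        have := topExponent_le (hd := hd) (r := r) (s := s) (l + 1)
        omega
      rw [Int.ceil_le, div_le_iff₀ (by exact_mod_cast hr _), mul_comm _ (r _ : ℚ)] at h3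
      exact_mod_cast h3
    -- The case `l = r_1` belongs to the first row of the second cycle, where the Newton height is
    -- `s_1`; the first block of `λ` still covers this row.
    · have h2 := heq ⟨1, by omega⟩ 0 (hr _) (Or.inr rfl)
      rw [newtonBound_zero, rowOffset, sum_Iio_of_val_eq_succ r (μ := firstCycle hd) (by rfl),
        sum_Iio_of_val_eq_succ s' (μ := firstCycle hd) (by rfl), sum_Iio_firstCycle,
        sum_Iio_firstCycle, zero_add, zero_add, add_zero] at h2
      have h3 := topExponent_le (hd := hd) (r := r) (s := s) (r (firstCycle hd) + 1)
      rw [mul_comm]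
      exact Nat.mul_le_mul_left _ (by omega)
  have hmid : ∀ μ, μ ≠ firstCycle hd → μ ≠ lastCycle hd → s' μ = 1 := by
    intro μ h1 h2
    have h3 := heq (lastCycle hd) 0 (hr _) (Or.inr rfl)
    have h4 : lamIndex hd r s (rowOffset r (lastCycle hd) + 1) ≤
        s' (firstCycle hd) + (d - 2) := by
      apply lamIndex_le
      rw [lastCycle_eq]
      exact rowOffset_succ_lt_partialSum ha ha1 _
    have h5 := topExponent_le (hd := hd) (r := r) (s := s) (rowOffset r (lastCycle hd) + 1)
    rw [add_zero, newtonBound_zero] at h3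
    have h6 : ∑ ν ∈ Finset.Iio (lastCycle hd), s' ν ≤ s' (firstCycle hd) + (d - 2) := by omega
    have h7 : ∀ ν, ν ≠ lastCycle hd → ν ∈ Finset.Iio (lastCycle hd) := by
      intro ν hν
      rw [Finset.mem_Iio, Fin.lt_def]
      have h4 : ν.val ≠ d - 1 := fun h => hν (Fin.ext h)
      have := ν.2
      simp only [lastCycle]
      omega
    have h8 : μ ∈ (Finset.Iio (lastCycle hd)).erase (firstCycle hd) :=
      Finset.mem_erase.mpr ⟨h1, h7 μ h2⟩
    rw [← Finset.add_sum_erase _ _ (h7 _ hfl), ← Finset.add_sum_erase _ _ h8] at h6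
    -- The other `d - 3` middle cycles contribute at least 1 each to a sum bounded by `s_1 + (d -
    -- 2)`, which leaves at most 1 for `s' μ`.
    have h9 : _ ≤ ∑ ν ∈ ((Finset.Iio (lastCycle hd)).erase (firstCycle hd)).erase μ, s' ν :=
      Finset.card_nsmul_le_sum _ s' 1 fun ν _ => hs1 ν
    rw [Finset.card_erase_of_mem h8, Finset.card_erase_of_mem (h7 _ hfl), Fin.card_Iio] at h9
    have hlc : (lastCycle hd).val = d - 1 := rfl
    rw [hlc, smul_eq_mul, mul_one] at h9
    have h10 := hs1 μ
    have h11 : 0 < μ.val := Nat.pos_of_ne_zero fun h => h1 (Fin.ext h)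
    have h12 : μ.val ≠ d - 1 := fun h => h2 (Fin.ext h)
    have h13 := μ.2
    omega
  have hmid' : ∀ μ, μ ≠ firstCycle hd → μ ≠ lastCycle hd → s μ = 1 := by
    intro μ h1 h2
    rw [hcast μ (htop μ h2), hmid μ h1 h2, Nat.cast_one]
  refine ⟨⟨⟨fun h => absurd h (htop _ hfl), fun n hn => ?_⟩, fun μ h1 h2 => Or.inl (hmid' μ h1 h2),
    ⟨fun h => by rw [hr1 h, Nat.cast_one], fun n hn => ?_⟩⟩, ?_⟩
  · have h1 : n = s' (firstCycle hd) := by exact_mod_cast hn.symm.trans ha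
    rw [← h1] at hfirst
    refine (Int.modEq_iff_dvd.mpr ?_).symm
    have : (n : ℤ) ∣ ((r (firstCycle hd) + 1 : ℕ) : ℤ) := Int.natCast_dvd_natCast.mpr hfirst
    simpa using this
  · have h1 : n = s' (lastCycle hd) := by
      exact_mod_cast hn.symm.trans (hcast _ (by simp [hn]))
    rw [← h1] at hdvd
    refine (Int.modEq_iff_dvd.mpr ?_).symm
    have : (n : ℤ) ∣ ((r (lastCycle hd) - 1 : ℕ) : ℤ) := Int.natCast_dvd_natCast.mpr hdvd
    rwa [Nat.cast_sub (hr _), Nat.cast_one] at this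
  · intro hd3
    -- Equal first and last ratios squeeze that of a middle cycle, whose `s` is 1. Hence `s_1`
    -- divides `r_1`, and coprimality leaves `s_1 = 1`.
    have hend : r (firstCycle hd) = r (lastCycle hd) → s (firstCycle hd) = s (lastCycle hd) →
        s (firstCycle hd) = 1 := by
      intro hrr hss
      have hm1 : (⟨1, by omega⟩ : Fin d) ≠ firstCycle hd := by simp [firstCycle]
      have hm2 : (⟨1, by omega⟩ : Fin d) ≠ lastCycle hd := by
        rw [lastCycle, Ne, Fin.mk.injEq]
        omega
      have hss' : s' (lastCycle hd) = s' (firstCycle hd) := by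
        rw [hs' _ (htop _ hfl), hs' _ (hss ▸ htop _ hfl), hss]
      have h1 := hord' (firstCycle hd) ⟨1, by omega⟩ (by simp [Fin.le_def, firstCycle])
      have h2 := hord' ⟨1, by omega⟩ (lastCycle hd) (by
        rw [Fin.le_def]
        simp only [lastCycle]
        omega)
      rw [hmid _ hm1 hm2, one_mul] at h1 h2
      rw [← hrr, hss'] at h2
      have h3 : s' (firstCycle hd) ∣ r (firstCycle hd) := ⟨_, le_antisymm h2 h1⟩
      have h4 := Nat.dvd_gcd h3 dvd_rfl
      rw [(hco' _ (htop _ hfl)).gcd_eq_one, Nat.dvd_one] at h4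
      rw [ha, h4, Nat.cast_one]
    intro μ ν hne hrr hss
    suffices h : s μ = 1 from ⟨h, hss ▸ h⟩
    by_cases h1 : μ = firstCycle hd
    · subst h1
      by_cases h2 : ν = lastCycle hd
      · subst h2
        exact hend hrr hss
      · rw [hss]
        exact hmid' ν hne.symm h2
    · by_cases h2 : μ = lastCycle hd
      · subst h2
        by_cases h3 : ν = firstCycle hd
        · subst h3
          rw [hss]
          exact hend hrr.symm hss.symm
        · rw [hss]
          exact hmid' ν h3 hne.symm
      · exact hmid' μ h1 h2
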